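/- Let $E$ be a simple Euclidean Jordan algebra: a nonzero finite-dimensional real inner product space with a commutative bilinear product $(x,y)\mapsto xy$ and a neutral element $e$ such that $x(x^2y)=x^2(xy)$ and $\langle x,yz\rangle=\langle xy,z\rangle$ for all $x,y,z$, which is not a Cartesian product of two Euclidean Jordan algebras of positive dimensions. Let $V$ be its (irreducible) symmetric cone, i.e. the interior of $\{x^2:x\in E\}$. Put $L(x)y=xy$ and $P(x)=2L(x)^2-L(x^2)$. For $x\in V$ let $x^{1/2}$ be the unique element of $V$ whose square is $x$, let $w_1(x)=P(x^{1/2})$, and let $g_1(x)=w_1(x)^{-1}=P(x^{-1/2})$. For $x\in E$ let $\det x=\prod_{i=1}^r\lambda_i$, where $x=\sum_{i=1}^r\lambda_i c_i$ is a spectral decomposition of $x$ along a complete system $(c_1,\dots,c_r)$ of primitive orthogonal idempotents. Let $D=\{x\in V: e-x\in V\}$ and $D_0=\{(x,y)\in D\times D: x+y\in D\}$. Assume that $f,g,h,k\colon D\to\mathbb{R}$ are continuous and that $$f(x)+g\bigl(g_1(e-x)y\bigr)=h(y)+k\bigl(g_1(e-y)x\bigr)\qquad\text{for all }(x,y)\in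 D_0.$$ Then there exist real constants $\kappa_1,\kappa_2,\kappa_3$ and $C_1,C_2,C_3,C_4$ such that for every $x\in D$ $$\begin{aligned} f(x)&=\kappa_1\log\det(e-x)+\kappa_2\log\det x+\kappa_3\log\det(e-x)+C_1,\\ g(x)&=\kappa_1\log\det(e-x)+\kappa_3\log\det x+C_2,\\ h(x)&=\kappa_1\log\det(e-x)+\kappa_2\log\det(e-x)+\kappa_3\log\det x+C_3,\\ k(x)&=\kappa_1\log\det(e-x)+\kappa_2\log\det x+C_4, \end{aligned}$$ and $C_1+C_2=C_3+C_4$. -/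

import Mathlib

/-- A Euclidean Jordan algebra on the Euclidean space `E`: a bilinear commutative product with a
neutral element, satisfying the Jordan identity, for which the scalar product is associative. -/
structure EuclideanJordanAlgebra (E : Type*) [NormedAddCommGroup E] [InnerProductSpace ℝ E] where
  /-- `E` is a Euclidean space, i.e. finite-dimensional. -/
  finiteDimensional : FiniteDimensional ℝ E
  /-- The Jordan product. As `mul x` is the map `y ↦ xy`, it is also the operator `L(x)`. -/
  mul : E →ₗ[ℝ] E →ₗ[ℝ] E
  /-- The neutral element `e`. -/
  e : E
  mul_comm : ∀ x y, mul x y = mul y x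
  jordan : ∀ x y, mul x (mul (mul x x) y) = mul (mul x x) (mul x y)
  mul_e : ∀ x, mul x e = x
  inner_mul : ∀ x y z, inner ℝ x (mul y z) = inner ℝ (mul x y) z

namespace EuclideanJordanAlgebra

variable {E : Type*} [NormedAddCommGroup E] [InnerProductSpace ℝ E]

/-- `E` is the (internal) Cartesian product of two subalgebras of positive dimension: it is the
direct sum of two nonzero subspaces, each closed under the product, which annihilate each other
(so that the product of `E` is computed component-wise). The components of `e` are then neutral
elements of the two factors, which inherit the other axioms from `E`. -/
def IsDecomposable (J : EuclideanJordanAlgebra E) : Prop :=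
  ∃ A B : Submodule ℝ E, A ≠ ⊥ ∧ B ≠ ⊥ ∧ IsCompl A B ∧
    (∀ x ∈ A, ∀ y ∈ A, J.mul x y ∈ A) ∧ (∀ x ∈ B, ∀ y ∈ B, J.mul x y ∈ B) ∧
    (∀ x ∈ A, ∀ y ∈ B, J.mul x y = 0)

/-- A simple Euclidean Jordan algebra: nonzero, and not a Cartesian product of two Euclidean Jordan
algebras of positive dimensions. -/
def IsSimple (J : EuclideanJordanAlgebra E) : Prop :=
  Nontrivial E ∧ ¬ J.IsDecomposable

/-- The quadratic representation `P(x) = 2 L(x)² - L(x²)`. -/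
def P (J : EuclideanJordanAlgebra E) (x : E) : Module.End ℝ E :=
  (2 : ℝ) • (J.mul x * J.mul x) - J.mul (J.mul x x)

/-- The symmetric cone `V`: the interior of the set of Jordan squares. -/
def cone (J : EuclideanJordanAlgebra E) : Set E :=
  interior {z | ∃ x, z = J.mul x x}

open Classical in
/-- The square root `x^{1/2}` of `x ∈ V`: the unique element of `V` whose square is `x`
(and `0` where there is no such element, which does not occur for `x ∈ V`). -/
noncomputable def sqrt (J : EuclideanJordanAlgebra E) (x : E) : E :=
  if hx : ∃ y ∈ J.cone, J.mul y y = x then hx.choose else 0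

/-- The multiplication algorithm `w₁(x) = P(x^{1/2})`. -/
noncomputable def w₁ (J : EuclideanJordanAlgebra E) (x : E) : Module.End ℝ E :=
  J.P (J.sqrt x)

/-- The division algorithm `g₁(x) = w₁(x)⁻¹`, the inverse being taken in the ring of linear
endomorphisms of `E`. -/
noncomputable def g₁ (J : EuclideanJordanAlgebra E) (x : E) : Module.End ℝ E :=
  Ring.inverse (J.w₁ x)

/-- Idempotents are nonzero by convention. -/
def IsIdempotent (J : EuclideanJordanAlgebra E) (c : E) : Prop :=
  J.mul c c = c ∧ c ≠ 0

/-- An idempotent is primitive if it is not a sum of two (nonzero) idempotents. -/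
def IsPrimitive (J : EuclideanJordanAlgebra E) (c : E) : Prop :=
  J.IsIdempotent c ∧ ¬ ∃ a b, J.IsIdempotent a ∧ J.IsIdempotent b ∧ c = a + b

/-- A complete system of primitive orthogonal idempotents. -/
def IsFrame (J : EuclideanJordanAlgebra E) {r : ℕ} (c : Fin r → E) : Prop :=
  (∀ i, J.IsPrimitive (c i)) ∧ (∀ i j, i ≠ j → J.mul (c i) (c j) = 0) ∧ ∑ i, c i = J.e

/-- `d` is the product of the eigenvalues `l i` in a spectral decomposition `x = ∑ i, l i • c i`
of `x` along a complete system of primitive orthogonal idempotents. -/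
def IsDet (J : EuclideanJordanAlgebra E) (x : E) (d : ℝ) : Prop :=
  ∃ (r : ℕ) (c : Fin r → E) (l : Fin r → ℝ),
    J.IsFrame c ∧ x = ∑ i, l i • c i ∧ d = ∏ i, l i

open Classical in
/-- The determinant of `x`: the product of the eigenvalues of `x`. By the spectral theorem every
element has a spectral decomposition, and its eigenvalues do not depend on the decomposition. -/
noncomputable def det (J : EuclideanJordanAlgebra E) (x : E) : ℝ :=
  if hx : ∃ d, J.IsDet x d then hx.choose else 0

/-- The set `D = {x ∈ V : e - x ∈ V}`. -/
def D (J : EuclideanJordanAlgebra E) : Set E :=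
  {x | x ∈ J.cone ∧ J.e - x ∈ J.cone}

/-- The set `D₀ = {(a, b) ∈ D² : a + b ∈ D}`. -/
def D₀ (J : EuclideanJordanAlgebra E) : Set (E × E) :=
  {p | p.1 ∈ J.D ∧ p.2 ∈ J.D ∧ p.1 + p.2 ∈ J.D}

end EuclideanJordanAlgebra

/-! Elements with a common frame (a complete system of primitive orthogonal idempotents) multiply
coordinatewise, so restricting the equation to a frame gives an equation for functions of r real
variables. With u = x/(1-x) as coordinate it reads F(s/(1+t)) + G(t) = H(t/(1+s)) + K(s) on the
positive orthant. Letting s or t tend to 0, and then both to infinity, yields logarithmic Cauchy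
equations, so F, G, H, K are combinations of logarithms of the coordinates
(`InformationEquation.exists_solution`).

The coefficients obtained depend on the frame, but their sums and the additive constants do not,
since every frame contains the multiples of e. Hence f, g, h, k are built from three continuous
functions A, B, G on the cone that are logarithmic along each frame (`exists_spectralLogs`). Fed
back into the full equation, which now couples noncommuting elements, small-argument limits give
A(u) + A(g₁(u)z) = A(z) on the whole cone, and likewise for B and G (`exists_logarithmic`).

It remains to see that such an A is a multiple of log det (`IsSimple.eq_log_det`). Put φ(z) = A(exp
z), the differential of A at e. It is linear (`IsLogarithmic.jexp_add`, `IsSpectralLog.jexp_smul`)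
and vanishes on the Peirce 1/2-space of every idempotent (`IsLogarithmic.jexp_half`). Hence for
primitive c, d the number φ(cd) is both ⟨c,d⟩φ(c)/‖c‖² and ⟨c,d⟩φ(d)/‖d‖², and non-orthogonal
primitive idempotents have equal norms, so φ(c) = φ(d) unless c and d are orthogonal. If φ took two
values on primitive idempotents, the spans of the corresponding classes would decompose E; by
simplicity φ is constant there, and that constant is κ.

The Jordan-theoretic background is proved on the way: power associativity, the spectral theorem,
Peirce weights, the fundamental formula and invariance of the cone under P(x) for x in the cone. -/

namespace EuclideanJordanAlgebra

variable {E : Type*} [NormedAddCommGroup E] [InnerProductSpace ℝ E]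

/-! ### Algebraic identities -/

/-- The full linearization of the Jordan identity. -/
lemma jordan_linearized (J : EuclideanJordanAlgebra E) (a b c y : E) :
    J.mul a (J.mul (J.mul b c) y) + J.mul b (J.mul (J.mul c a) y)
      + J.mul c (J.mul (J.mul a b) y)
    = J.mul (J.mul b c) (J.mul a y) + J.mul (J.mul c a) (J.mul b y)
      + J.mul (J.mul a b) (J.mul c y) := by
  have h1 := J.jordan (a + b + c) y
  have h2 := J.jordan (a + b) y
  have h3 := J.jordan (b + c) y
  have h4 := J.jordan (a + c) y
  have ha := J.jordan a y
  have hb := J.jordan b y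
  have hc := J.jordan c y
  simp only [map_add, LinearMap.add_apply, J.mul_comm b a, J.mul_comm c a, J.mul_comm c b]
    at h1 h2 h3 h4 ⊢
  linear_combination (norm := module) (1 / 2 : ℝ) • (h1 - h2 - h3 - h4 + ha + hb + hc)

/-- The infinitesimal form of the fundamental formula. -/
lemma mul_P_add_P_mul (J : EuclideanJordanAlgebra E) (a y w : E) :
    J.mul a (J.P y w) + J.P y (J.mul a w)
    = (2 : ℝ) • (J.mul (J.mul a y) (J.mul y w) + J.mul y (J.mul (J.mul a y) w)
        - J.mul (J.mul y (J.mul a y)) w) := by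
  have h2 := J.jordan_linearized a y y w
  have h3 := J.jordan_linearized a y w y
  simp only [P, LinearMap.sub_apply, LinearMap.smul_apply, Module.End.mul_apply, map_sub,
    map_smul]
  simp only [J.mul_comm y a, J.mul_comm w a, J.mul_comm w y] at h2 h3
  rw [J.mul_comm (J.mul y w) y, J.mul_comm (J.mul a w) y, J.mul_comm w (J.mul (J.mul a y) y),
    J.mul_comm (J.mul a y) y, J.mul_comm (J.mul y w) (J.mul a y),
    J.mul_comm (J.mul a w) (J.mul y y)] at h3
  linear_combination (norm := module) (2 : ℝ) • h3 - h2

lemma P_self (J : EuclideanJordanAlgebra E) (x y : E) :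
    J.P x y = (2 : ℝ) • J.mul x (J.mul x y) - J.mul (J.mul x x) y := rfl

lemma e_mul (J : EuclideanJordanAlgebra E) (x : E) : J.mul J.e x = x := by
  rw [J.mul_comm, J.mul_e]

lemma P_apply_e (J : EuclideanJordanAlgebra E) (x : E) : J.P x J.e = J.mul x x := by
  rw [P_self, J.mul_e, J.mul_e]; module

lemma P_e (J : EuclideanJordanAlgebra E) : J.P J.e = 1 := by
  ext x
  rw [P_self, J.mul_e, J.e_mul, J.e_mul, Module.End.one_apply]; module

lemma P_smul (J : EuclideanJordanAlgebra E) (t : ℝ) (x : E) : J.P (t • x) = t ^ 2 • J.P x := by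
  ext y
  simp only [P_self, map_smul, LinearMap.smul_apply, smul_sub, smul_smul]
  congr 2; ring
  ring

lemma mul_symm (J : EuclideanJordanAlgebra E) (x : E) : (J.mul x).IsSymmetric := fun y z => by
  rw [J.mul_comm x y, J.inner_mul]

lemma P_symm (J : EuclideanJordanAlgebra E) (x : E) : (J.P x).IsSymmetric := fun y z => by
  simp only [P_self, inner_sub_left, inner_sub_right, inner_smul_left, inner_smul_right]
  rw [J.mul_symm x, J.mul_symm x, J.mul_symm (J.mul x x)]
  simp

lemma inner_sq (J : EuclideanJordanAlgebra E) (x y : E) :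
    inner ℝ x (J.mul y y) = inner ℝ (J.mul x y) y := J.inner_mul x y y

/-! ### Idempotents -/

/-- The linearized Jordan identity at (c, c, y), applied to c. It says L(2L - 1)(L - 1) = 0 for L =
L(c), the source of the Peirce eigenvalues 0, 1/2, 1. -/
lemma idem_cubic (J : EuclideanJordanAlgebra E) {c : E} (hc : J.mul c c = c) (y : E) :
    (2 : ℝ) • J.mul c (J.mul c (J.mul c y)) = (3 : ℝ) • J.mul c (J.mul c y) - J.mul c y := by
  have h := J.jordan_linearized c c y c
  rw [hc] at h
  rw [J.mul_comm (J.mul c y) c, J.mul_comm y (J.mul c c), hc, J.mul_comm y c,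
    J.mul_comm (J.mul c y) c] at h
  linear_combination (norm := module) h

lemma idem_weight (J : EuclideanJordanAlgebra E) {c y : E} (hc : J.mul c c = c) {p : ℝ}
    (hy : J.mul c y = p • y) (h0 : y ≠ 0) : p = 0 ∨ p = 1 / 2 ∨ p = 1 := by
  have h := J.idem_cubic hc y
  simp only [hy, map_smul, smul_smul] at h
  have : (2 * (p * (p * p)) - 3 * (p * p) + p) • y = 0 := by
    linear_combination (norm := module) h
  rcases smul_eq_zero.1 this with h | h
  · have : p * ((2 * p - 1) * (p - 1)) = 0 := by linear_combination h
    rcases mul_eq_zero.1 this with h | h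
    · exact Or.inl h
    rcases mul_eq_zero.1 h with h | h
    · right; left; linarith
    · right; right; linarith
  · exact absurd h h0

lemma idem_mul_nonneg (J : EuclideanJordanAlgebra E) {c : E} (hc : J.mul c c = c) (y : E) :
    0 ≤ inner ℝ (J.mul c y) y := by
  set L := J.mul c
  have h := J.idem_cubic hc y
  have h1 := congrArg (fun z => inner ℝ z y) h
  have s1 : inner ℝ (L (L (L y))) y = inner ℝ (L (L y)) (L y) := by
    rw [J.mul_symm c]
  have s2 : inner ℝ (L (L y)) y = inner ℝ (L y) (L y) := by rw [J.mul_symm c]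
  have h2 := congrArg (fun z => inner ℝ z (L y)) h
  have s3 : inner ℝ (L (L (L y))) (L y) = inner ℝ (L (L y)) (L (L y)) := by
    rw [J.mul_symm c]
  simp only [inner_sub_left, inner_smul_left, map_ofNat] at h1 h2
  change 2 * inner ℝ (L (L (L y))) y = 3 * inner ℝ (L (L y)) y - inner ℝ (L y) y at h1
  change 2 * inner ℝ (L (L (L y))) (L y) = 3 * inner ℝ (L (L y)) (L y) - inner ℝ (L y) (L y) at h2
  rw [s1, s2] at h1
  rw [s3] at h2
  -- Modulo the cubic relation, L = 8(L - L²)² + (2L² - L)², a sum of squares of self-adjoint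
  -- operators.
  have n1 : 0 ≤ inner ℝ (L y - L (L y)) (L y - L (L y)) := real_inner_self_nonneg
  have n3 : 0 ≤ inner ℝ ((2:ℝ) • L (L y) - L y) ((2:ℝ) • L (L y) - L y) := real_inner_self_nonneg
  simp only [inner_sub_left, inner_sub_right, inner_smul_left, inner_smul_right,
    conj_trivial] at n1 n3
  rw [real_inner_comm (L (L y)) (L y)] at n1 n3
  linarith

lemma idem_mul_eq_zero (J : EuclideanJordanAlgebra E) {c y : E} (hc : J.mul c c = c)
    (h : inner ℝ (J.mul c y) y = 0) : J.mul c y = 0 := by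
  -- a positive semidefinite form vanishing at `y` has `y` in its kernel
  set v := J.mul c y
  by_contra hv
  have hvv : 0 < inner ℝ v v := real_inner_self_pos.2 hv
  have key : ∀ t : ℝ, 0 ≤ 2 * t * inner ℝ v v + t ^ 2 * inner ℝ (J.mul c v) v := by
    intro t
    have := J.idem_mul_nonneg hc (y + t • v)
    simp only [map_add, map_smul, inner_add_left, inner_add_right, inner_smul_left,
      inner_smul_right, conj_trivial] at this
    have e1 : inner ℝ (J.mul c v) y = inner ℝ v v := by rw [J.mul_symm c]
    rw [e1] at this
    change 0 ≤ inner ℝ v y + t * inner ℝ v v + t * (inner ℝ v v + t * inner ℝ (J.mul c v) v)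
      at this
    rw [h] at this
    linarith
  set m := inner ℝ (J.mul c v) v
  have hm : 0 ≤ m := J.idem_mul_nonneg hc v
  -- A small negative t makes the linear term dominate; m + 1 instead of m avoids dividing by zero.
  have := key (-(inner ℝ v v) / (m + 1))
  set s := inner ℝ v v
  have hm1 : 0 < m + 1 := by linarith
  have e : 2 * (-s / (m + 1)) * s + (-s / (m + 1)) ^ 2 * m
      = -(s ^ 2 * (m + 2)) / (m + 1) ^ 2 := by
    field_simp; ring
  rw [e] at this
  have : 0 < (s ^ 2 * (m + 2)) / (m + 1) ^ 2 := by positivity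
  rw [neg_div] at *
  linarith

lemma idem_inner_nonneg (J : EuclideanJordanAlgebra E) {c d : E} (hc : J.mul c c = c)
    (hd : J.mul d d = d) : 0 ≤ inner ℝ c d := by
  have := J.idem_mul_nonneg hc d
  rwa [← J.inner_sq, hd] at this

/-- Since d = d², ⟨c, d⟩ = ⟨cd, d⟩ is the value at d of the positive semidefinite form of L(c); if
it vanishes, d lies in the kernel. -/
lemma idem_orthogonal (J : EuclideanJordanAlgebra E) {c d : E} (hc : J.mul c c = c)
    (hd : J.mul d d = d) (h : inner ℝ c d = 0) : J.mul c d = 0 := by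
  apply J.idem_mul_eq_zero hc
  rw [← J.inner_sq, hd, h]

lemma inner_eq_zero_of_mul (J : EuclideanJordanAlgebra E) {c d : E} (hd : J.mul d d = d)
    (h : J.mul c d = 0) : inner ℝ c d = 0 := by
  rw [← hd, J.inner_sq, h, inner_zero_left]

lemma idem_compl (J : EuclideanJordanAlgebra E) {c : E} (hc : J.mul c c = c) :
    J.mul (J.e - c) (J.e - c) = J.e - c := by
  simp only [map_sub, LinearMap.sub_apply, J.mul_e, J.e_mul, hc]; abel

lemma mul_idem_commute (J : EuclideanJordanAlgebra E) {c d : E} (hc : J.mul c c = c)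
    (h : J.mul c d = 0) : Commute (J.mul c) (J.mul d) := by
  ext y
  have := J.jordan_linearized c c d y
  rw [h, J.mul_comm d c, h, hc] at this
  simp only [map_zero, LinearMap.zero_apply, zero_add] at this
  exact this.symm

/-! ### Power associativity -/

/-- The linearized identity expresses L(x(xz)) through L(x), L(x²), L(z) and L(xz). With z = xⁿ this
puts L(xⁿ⁺²) in the algebra generated by operators already known to commute with L(x) and L(x²);
both commutations must be carried through the induction. -/
lemma mul_comm_pow_aux (J : EuclideanJordanAlgebra E) (x : E) (n : ℕ) :
    Commute (J.mul (((J.mul x) ^ n) J.e)) (J.mul x) ∧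
    Commute (J.mul (((J.mul x) ^ n) J.e)) (J.mul (J.mul x x)) := by
  have hx2 : Commute (J.mul x) (J.mul (J.mul x x)) := by
    ext y; exact J.jordan x y
  induction n using Nat.strong_induction_on with
  | _ n ih =>
    match n with
    | 0 =>
      have : J.mul J.e = 1 := by ext y; simp [J.e_mul]
      simp only [pow_zero, Module.End.one_apply, this]
      exact ⟨Commute.one_left _, Commute.one_left _⟩
    | 1 =>
      simp only [pow_one, J.mul_e]
      exact ⟨Commute.refl _, hx2⟩
    | n + 2 =>
      obtain ⟨a1, a2⟩ := ih n (by omega)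
      obtain ⟨b1, b2⟩ := ih (n + 1) (by omega)
      set z := ((J.mul x) ^ n) J.e
      have hz1 : ((J.mul x) ^ (n + 1)) J.e = J.mul x z := by rw [pow_succ']; rfl
      have hz2 : ((J.mul x) ^ (n + 2)) J.e = J.mul x (J.mul x z) := by
        rw [pow_succ', Module.End.mul_apply, hz1]
      rw [hz1] at b1 b2
      have key : J.mul (J.mul x (J.mul x z)) = (2 : ℝ) • (J.mul x * J.mul (J.mul x z))
          + J.mul z * J.mul (J.mul x x) - J.mul x * J.mul x * J.mul z
          - J.mul z * (J.mul x * J.mul x) := by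
        ext y
        have h := J.jordan_linearized x y z x
        simp only [LinearMap.sub_apply, LinearMap.add_apply, LinearMap.smul_apply,
          Module.End.mul_apply]
        have c1 := LinearMap.congr_fun b1 y
        have c2 := LinearMap.congr_fun a2 y
        simp only [Module.End.mul_apply] at c1 c2
        rw [J.mul_comm (J.mul y z) x, J.mul_comm y z, J.mul_comm z x,
          J.mul_comm (J.mul x z) x, J.mul_comm y (J.mul x (J.mul x z)),
          J.mul_comm (J.mul x y) x, J.mul_comm (J.mul z y) (J.mul x x),
          J.mul_comm y x, J.mul_comm (J.mul x y) (J.mul x z)] at h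
        rw [J.mul_comm z (J.mul x (J.mul x y))] at h
        rw [J.mul_comm z (J.mul x (J.mul x y))]
        linear_combination (norm := module) h + (2 : ℝ) • c1 - c2
      rw [hz2, key]
      constructor
      · exact (((((Commute.refl _).mul_left b1).smul_left _).add_left
          (a1.mul_left hx2.symm)).sub_left (((Commute.refl _).mul_left (Commute.refl _)).mul_left
          a1)).sub_left (a1.mul_left ((Commute.refl _).mul_left (Commute.refl _)))
      · exact ((((hx2.mul_left b2).smul_left _).add_left
          (a2.mul_left (Commute.refl _))).sub_left ((hx2.mul_left hx2).mul_left
          a2)).sub_left (a2.mul_left (hx2.mul_left hx2))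

lemma pow_mul_pow (J : EuclideanJordanAlgebra E) (x : E) (m n : ℕ) :
    J.mul (((J.mul x) ^ m) J.e) (((J.mul x) ^ n) J.e) = ((J.mul x) ^ (m + n)) J.e := by
  have h := LinearMap.congr_fun ((J.mul_comm_pow_aux x m).1.pow_right n) J.e
  simp only [Module.End.mul_apply, J.mul_e] at h
  rw [h, add_comm, pow_add, Module.End.mul_apply]

open Polynomial in
lemma aeval_mul_aeval (J : EuclideanJordanAlgebra E) (x : E) (p q : ℝ[X]) :
    J.mul (aeval (J.mul x) p J.e) (aeval (J.mul x) q J.e) = aeval (J.mul x) (p * q) J.e := by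
  induction p using Polynomial.induction_on' with
  | add p p' h h' => simp only [map_add, LinearMap.add_apply, add_mul, h, h']
  | monomial n a =>
    induction q using Polynomial.induction_on' with
    | add q q' h h' => simp only [map_add, LinearMap.add_apply, mul_add, h, h']
    | monomial m b =>
      rw [monomial_mul_monomial]
      simp only [aeval_monomial, Module.End.mul_apply, Module.algebraMap_end_apply,
        map_smul, LinearMap.smul_apply, J.pow_mul_pow, smul_smul,
        _root_.mul_comm b a]

/-! ### Complete systems of orthogonal idempotents -/

/-- A complete system of orthogonal, possibly zero, possibly imprimitive idempotents. -/
structure IsSystem (J : EuclideanJordanAlgebra E) {ι : Type*} [Fintype ι] (c : ι → E) : Prop where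
  idem : ∀ i, J.mul (c i) (c i) = c i
  orth : ∀ i j, i ≠ j → J.mul (c i) (c j) = 0
  sum_eq : ∑ i, c i = J.e

lemma IsFrame.isSystem {J : EuclideanJordanAlgebra E} {r : ℕ} {c : Fin r → E}
    (hc : J.IsFrame c) : J.IsSystem c :=
  ⟨fun i => (hc.1 i).1.1, hc.2.1, hc.2.2⟩

lemma IsFrame.ne_zero {J : EuclideanJordanAlgebra E} {r : ℕ} {c : Fin r → E}
    (hc : J.IsFrame c) (i : Fin r) : c i ≠ 0 := (hc.1 i).1.2

section System

variable {J : EuclideanJordanAlgebra E} {ι : Type*} [Fintype ι] {c : ι → E}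

lemma isSystem_pair (J : EuclideanJordanAlgebra E) {c : E} (hc : J.mul c c = c) :
    J.IsSystem (fun b : Bool => if b then c else J.e - c) := by
  have h : J.mul c (J.e - c) = 0 := by rw [map_sub, J.mul_e, hc, sub_self]
  refine ⟨?_, ?_, ?_⟩
  · rintro (_ | _)
    · simpa using J.idem_compl hc
    · simpa using hc
  · rintro (_ | _) (_ | _) hij
    · exact absurd rfl hij
    · simpa [J.mul_comm _ c] using h
    · simpa using h
    · exact absurd rfl hij
  · simp

lemma IsSystem.mul_single (hc : J.IsSystem c) (a : ι → ℝ) (j : ι) :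
    J.mul (∑ i, a i • c i) (c j) = a j • c j := by
  classical
  rw [map_sum, LinearMap.sum_apply, Finset.sum_eq_single j]
  · simp [hc.idem]
  · intro i _ hij; simp [hc.orth i j hij]
  · simp

lemma IsSystem.mul_sum (hc : J.IsSystem c) (a b : ι → ℝ) :
    J.mul (∑ i, a i • c i) (∑ i, b i • c i) = ∑ i, (a i * b i) • c i := by
  rw [map_sum]
  refine Finset.sum_congr rfl fun j _ => ?_
  rw [map_smul, hc.mul_single, smul_smul, _root_.mul_comm]

lemma IsSystem.smul_e (hc : J.IsSystem c) (t : ℝ) : t • J.e = ∑ i, t • c i := by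
  rw [← Finset.smul_sum, hc.sum_eq]

lemma IsSystem.e_sub (hc : J.IsSystem c) (a : ι → ℝ) :
    J.e - ∑ i, a i • c i = ∑ i, (1 - a i) • c i := by
  rw [← hc.sum_eq, ← Finset.sum_sub_distrib]
  exact Finset.sum_congr rfl fun i _ => by module

lemma IsSystem.inner_single (hc : J.IsSystem c) (a : ι → ℝ) (j : ι) :
    inner ℝ (∑ i, a i • c i) (c j) = a j * ‖c j‖ ^ 2 := by
  have h : inner ℝ (∑ i, a i • c i) (c j) = inner ℝ (∑ i, a i • c i) (J.mul (c j) (c j)) := by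
    rw [hc.idem]
  rw [h, J.inner_sq, hc.mul_single, inner_smul_left, real_inner_self_eq_norm_sq]; simp

lemma IsSystem.norm_sq (hc : J.IsSystem c) (a : ι → ℝ) :
    ‖∑ i, a i • c i‖ ^ 2 = ∑ i, a i ^ 2 * ‖c i‖ ^ 2 := by
  rw [← real_inner_self_eq_norm_sq, inner_sum]
  refine Finset.sum_congr rfl fun j _ => ?_
  rw [inner_smul_right, hc.inner_single]; ring

lemma IsSystem.commute (hc : J.IsSystem c) (i j : ι) :
    Commute (J.mul (c i)) (J.mul (c j)) := by
  classical
  by_cases hij : i = j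
  · subst hij; exact Commute.refl _
  · exact J.mul_idem_commute (hc.idem i) (hc.orth i j hij)

end System

/-! ### The spectral theorem -/

open Polynomial in
lemma aeval_mul_eq_zero (J : EuclideanJordanAlgebra E) (x : E) (p : ℝ[X])
    (hp : ∀ μ, Module.End.HasEigenvalue (J.mul x) μ → p.eval μ = 0) :
    aeval (J.mul x) p = 0 := by
  have := J.finiteDimensional
  have htop : ⨆ μ, Module.End.eigenspace (J.mul x) μ = ⊤ :=
    Submodule.orthogonal_eq_bot_iff.mp (J.mul_symm x).orthogonalComplement_iSup_eigenspaces_eq_bot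
  rw [← LinearMap.ker_eq_top, eq_top_iff, ← htop, iSup_le_iff]
  intro μ y hy
  by_cases h0 : y = 0
  · simp [h0]
  have hv : Module.End.HasEigenvector (J.mul x) μ y := ⟨hy, h0⟩
  rw [LinearMap.mem_ker, Module.End.aeval_apply_of_hasEigenvector hv,
    hp μ (Module.End.hasEigenvalue_of_hasEigenvector hv), zero_smul]

open Polynomial in
-- The idempotents are the Lagrange basis polynomials at the eigenvalues of L(x), evaluated at L(x)
-- and applied to e; power associativity turns products of polynomials into Jordan products. Not
-- every eigenvalue of L(x) need be an eigenvalue of x, so some of these idempotents may be zero.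
lemma exists_coarse_spectral (J : EuclideanJordanAlgebra E) (x : E) :
    ∃ (s : Finset ℝ) (c : s → E), J.IsSystem c ∧ x = ∑ i : s, (i : ℝ) • c i := by
  classical
  have := J.finiteDimensional
  set T := J.mul x
  have hfin : {μ | Module.End.HasEigenvalue T μ}.Finite := Module.End.finite_hasEigenvalue T
  set s := hfin.toFinset
  have hs : ∀ μ, Module.End.HasEigenvalue T μ → μ ∈ s := fun μ h => by simpa [s] using h
  have hinj : Set.InjOn (id : ℝ → ℝ) s := Function.injective_id.injOn
  let b : s → ℝ[X] := fun i => Lagrange.basis s id (i : ℝ)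
  have hb1 : ∀ i : s, (b i).eval (i : ℝ) = 1 := fun i => by
    simpa using Lagrange.eval_basis_self hinj i.2
  have hb0 : ∀ i j : s, i ≠ j → (b i).eval (j : ℝ) = 0 := fun i j hij => by
    have : (i : ℝ) ≠ (j : ℝ) := fun h => hij (Subtype.ext h)
    simpa using Lagrange.eval_basis_of_ne (v := (id : ℝ → ℝ)) (s := s) this j.2
  have hsum : ∀ (g : ℝ → ℝ) (j : s), ∑ i : s, g i * (b i).eval (j : ℝ) = g j := by
    intro g j
    rw [Finset.sum_eq_single j]
    · rw [hb1, mul_one]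
    · intro i _ hij; rw [hb0 i j hij, mul_zero]
    · simp
  have haux : ∀ p q : ℝ[X], (∀ j : s, p.eval (j : ℝ) = q.eval (j : ℝ)) →
      aeval T p = aeval T q := by
    intro p q h
    rw [← sub_eq_zero, ← map_sub]
    refine J.aeval_mul_eq_zero x _ fun μ hμ => ?_
    rw [eval_sub, h ⟨μ, hs μ hμ⟩, sub_self]
  refine ⟨s, fun i => aeval T (b i) J.e, ⟨fun i => ?_, fun i j hij => ?_, ?_⟩, ?_⟩
  · rw [J.aeval_mul_aeval, haux (b i * b i) (b i)]
    intro j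
    rw [eval_mul]
    by_cases hij : i = j
    · rw [hij, hb1, mul_one]
    · rw [hb0 i j hij, mul_zero]
  · rw [J.aeval_mul_aeval, haux (b i * b j) 0, map_zero, LinearMap.zero_apply]
    intro k
    rw [eval_mul, eval_zero]
    by_cases hik : i = k
    · rw [hb0 j k (by rw [← hik]; exact hij.symm), mul_zero]
    · rw [hb0 i k hik, zero_mul]
  · have : aeval T (∑ i : s, b i) = aeval T (1 : ℝ[X]) := by
      apply haux
      intro j
      rw [eval_finsetSum, eval_one]
      simpa using hsum (fun _ => 1) j
    rw [map_sum, map_one] at this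
    have := LinearMap.congr_fun this J.e
    simpa using this
  · have : aeval T (∑ i : s, C (i : ℝ) * b i) = aeval T (X : ℝ[X]) := by
      apply haux
      intro j
      rw [eval_finsetSum, eval_X]
      simpa using hsum (fun t => t) j
    rw [map_sum, aeval_X] at this
    have := LinearMap.congr_fun this J.e
    simp only [T, J.mul_e] at this
    rw [← this]
    simp [T]

/-- The data of a decomposition of `x` along a finite set of orthogonal nonzero idempotents. -/
def IsDecomposition (J : EuclideanJordanAlgebra E) (x : E) (S : Finset E) (l : E → ℝ) : Prop :=
  (∀ c ∈ S, J.IsIdempotent c) ∧ (∀ c ∈ S, ∀ d ∈ S, c ≠ d → J.mul c d = 0) ∧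
    ∑ c ∈ S, c = J.e ∧ x = ∑ c ∈ S, l c • c

lemma exists_isDecomposition (J : EuclideanJordanAlgebra E) (x : E) :
    ∃ S l, J.IsDecomposition x S l := by
  classical
  obtain ⟨s, c, hc, hx⟩ := J.exists_coarse_spectral x
  let t : Finset s := Finset.univ.filter fun i => c i ≠ 0
  have hinj : Set.InjOn c t := by
    intro i hi j hj hij
    by_contra hne
    have := hc.orth i j hne
    rw [← hij, hc.idem] at this
    exact (Finset.mem_filter.1 hi).2 this
  have hne : ∀ i ∈ t, c i ≠ 0 := fun i hi => (Finset.mem_filter.1 hi).2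
  have hsum : ∀ g : s → ℝ, ∑ i ∈ t, g i • c i = ∑ i, g i • c i := by
    intro g
    apply Finset.sum_subset (Finset.subset_univ _)
    intro i _ hi
    have : c i = 0 := by simpa [t] using hi
    simp [this]
  let l : E → ℝ := fun y => if h : ∃ i ∈ t, c i = y then (h.choose : ℝ) else 0
  have hl : ∀ i ∈ t, l (c i) = i := by
    intro i hi
    have h : ∃ j ∈ t, c j = c i := ⟨i, hi, rfl⟩
    have e : l (c i) = (h.choose : ℝ) := dif_pos h
    rw [e, hinj h.choose_spec.1 hi h.choose_spec.2]
  refine ⟨t.image c, l, ?_, ?_, ?_, ?_⟩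
  · intro y hy
    obtain ⟨i, hi, rfl⟩ := Finset.mem_image.1 hy
    exact ⟨hc.idem i, hne i hi⟩
  · intro y hy z hz hyz
    obtain ⟨i, hi, rfl⟩ := Finset.mem_image.1 hy
    obtain ⟨j, hj, rfl⟩ := Finset.mem_image.1 hz
    exact hc.orth i j fun h => hyz (by rw [h])
  · rw [Finset.sum_image hinj, ← hc.sum_eq]
    simpa using hsum fun _ => 1
  · rw [Finset.sum_image hinj, hx, ← hsum]
    exact Finset.sum_congr rfl fun i hi => by rw [hl i hi]

lemma IsDecomposition.card_le {J : EuclideanJordanAlgebra E} {x : E} {S : Finset E} {l : E → ℝ}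
    (h : J.IsDecomposition x S l) : S.card ≤ Module.finrank ℝ E := by
  have := J.finiteDimensional
  have : LinearIndependent ℝ (fun c : S => (c : E)) := by
    apply linearIndependent_of_ne_zero_of_inner_eq_zero
    · exact fun c => (h.1 c c.2).2
    · intro c d hcd
      exact J.inner_eq_zero_of_mul (h.1 d d.2).1
        (h.2.1 c c.2 d d.2 fun e => hcd (Subtype.ext e))
  simpa using this.fintype_card_le_finrank

/-- For another member d, ⟨a, d⟩ and ⟨b, d⟩ are nonnegative with sum ⟨c, d⟩ = 0, so both vanish and
a, b stay orthogonal to the rest of the system. -/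
lemma IsDecomposition.split {J : EuclideanJordanAlgebra E} {x : E} {S : Finset E} {l : E → ℝ}
    (h : J.IsDecomposition x S l) {c a b : E} (hc : c ∈ S) (ha : J.IsIdempotent a)
    (hb : J.IsIdempotent b) (hab : c = a + b) :
    ∃ S' l', J.IsDecomposition x S' l' ∧ S'.card = S.card + 1 := by
  classical
  have hab0 : J.mul a b = 0 := by
    have := (h.1 c hc).1
    rw [hab] at this
    simp only [map_add, LinearMap.add_apply, ha.1, hb.1, J.mul_comm b a] at this
    have h2 : (2 : ℝ) • J.mul a b = 0 := by linear_combination (norm := module) this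
    exact (smul_eq_zero.1 h2).resolve_left two_ne_zero
  have hin : ∀ d ∈ S, d ≠ c → inner ℝ a d = 0 ∧ inner ℝ b d = 0 := by
    intro d hd hdc
    have h0 := J.inner_eq_zero_of_mul (h.1 d hd).1 (h.2.1 c hc d hd hdc.symm)
    rw [hab, inner_add_left] at h0
    have h1 := J.idem_inner_nonneg ha.1 (h.1 d hd).1
    have h2 := J.idem_inner_nonneg hb.1 (h.1 d hd).1
    constructor <;> linarith
  have had : ∀ d ∈ S, d ≠ c → J.mul a d = 0 := fun d hd hdc =>
    J.idem_orthogonal ha.1 (h.1 d hd).1 (hin d hd hdc).1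
  have hbd : ∀ d ∈ S, d ≠ c → J.mul b d = 0 := fun d hd hdc =>
    J.idem_orthogonal hb.1 (h.1 d hd).1 (hin d hd hdc).2
  have hne : a ≠ b := fun e => ha.2 (by rw [← ha.1]; nth_rewrite 2 [e]; exact hab0)
  have haS : a ∉ S.erase c := fun hm => by
    have := had a (Finset.mem_of_mem_erase hm) (Finset.ne_of_mem_erase hm)
    exact ha.2 (ha.1 ▸ this)
  have hbS : b ∉ S.erase c := fun hm => by
    have := hbd b (Finset.mem_of_mem_erase hm) (Finset.ne_of_mem_erase hm)
    exact hb.2 (hb.1 ▸ this)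
  have haI : a ∉ insert b (S.erase c) := by simp only [Finset.mem_insert, not_or]; exact ⟨hne, haS⟩
  let l' : E → ℝ := fun y => if y = a ∨ y = b then l c else l y
  refine ⟨insert a (insert b (S.erase c)), l', ⟨?_, ?_, ?_, ?_⟩, ?_⟩
  · intro y hy
    simp only [Finset.mem_insert] at hy
    rcases hy with rfl | rfl | hy
    · exact ha
    · exact hb
    · exact h.1 y (Finset.mem_of_mem_erase hy)
  · intro y hy z hz hyz
    simp only [Finset.mem_insert, Finset.mem_erase] at hy hz
    rcases hy with rfl | rfl | hy <;> rcases hz with rfl | rfl | hz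
    · exact absurd rfl hyz
    · exact hab0
    · exact had z hz.2 hz.1
    · rw [J.mul_comm]; exact hab0
    · exact absurd rfl hyz
    · exact hbd z hz.2 hz.1
    · rw [J.mul_comm]; exact had y hy.2 hy.1
    · rw [J.mul_comm]; exact hbd y hy.2 hy.1
    · exact h.2.1 y hy.2 z hz.2 hyz
  · rw [Finset.sum_insert haI, Finset.sum_insert hbS, ← add_assoc, ← hab,
      Finset.add_sum_erase S (fun y => y) hc, h.2.2.1]
  · rw [Finset.sum_insert haI, Finset.sum_insert hbS, h.2.2.2, ← Finset.add_sum_erase _ _ hc]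
    have h1 : l' a = l c := by simp [l']
    have h2 : l' b = l c := by simp [l']
    have h3 : ∑ y ∈ S.erase c, l' y • y = ∑ y ∈ S.erase c, l y • y := by
      refine Finset.sum_congr rfl fun y hy => ?_
      have : ¬ (y = a ∨ y = b) := by
        rintro (rfl | rfl)
        · exact haS hy
        · exact hbS hy
      simp only [l', if_neg this]
    rw [h1, h2, h3, hab, smul_add, add_assoc]
  · rw [Finset.card_insert_of_notMem haI, Finset.card_insert_of_notMem hbS,
      Finset.card_erase_of_mem hc]
    have := Finset.card_pos.2 ⟨c, hc⟩
    omega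

/-- The spectral theorem. -/
theorem exists_frame (J : EuclideanJordanAlgebra E) (x : E) :
    ∃ (r : ℕ) (c : Fin r → E) (l : Fin r → ℝ), J.IsFrame c ∧ x = ∑ i, l i • c i := by
  classical
  -- A decomposition with the largest possible number of idempotents has only primitive ones, for
  -- otherwise it could be split further; orthogonality bounds the number by the dimension.
  let N : ℕ → Prop := fun n => ∃ S l, J.IsDecomposition x S l ∧ S.card = n
  have hN : ∃ n, N n := by
    obtain ⟨S, l, h⟩ := J.exists_isDecomposition x
    exact ⟨_, S, l, h, rfl⟩
  have hbd : ∀ n, N n → n ≤ Module.finrank ℝ E := by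
    rintro n ⟨S, l, h, rfl⟩; exact h.card_le
  obtain ⟨n0, hn0⟩ := hN
  have hfg := Nat.findGreatest_spec (hbd n0 hn0) hn0
  have hmax : ∀ n, N n → n ≤ Nat.findGreatest N (Module.finrank ℝ E) := fun n hn =>
    Nat.le_findGreatest (hbd n hn) hn
  obtain ⟨S, l, h, hS⟩ := hfg
  let f := S.equivFin.symm
  refine ⟨S.card, fun i => f i, fun i => l (f i), ⟨fun i => ⟨h.1 _ (f i).2, ?_⟩, ?_, ?_⟩, ?_⟩
  · rintro ⟨a, b, ha, hb, hab⟩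
    obtain ⟨S', l', h', hS'⟩ := h.split (f i).2 ha hb hab
    have := hmax _ ⟨S', l', h', rfl⟩
    omega
  · intro i j hij
    exact h.2.1 _ (f i).2 _ (f j).2 fun e => hij (f.injective (Subtype.ext e))
  · rw [f.sum_comp (fun c : S => (c : E)), Finset.sum_coe_sort S (fun c => c), h.2.2.1]
  · rw [f.sum_comp (fun c : S => l c • (c : E)), Finset.sum_coe_sort S (fun c => l c • c)]
    exact h.2.2.2

open Filter Topology

/-! ### Continuity of the operations -/

/-- The product as a bounded bilinear map. -/
noncomputable def mulL (J : EuclideanJordanAlgebra E) : E →L[ℝ] E →L[ℝ] E :=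
  have := J.finiteDimensional
  J.mul.toContinuousBilinearMap

lemma mulL_apply (J : EuclideanJordanAlgebra E) (x y : E) : J.mulL x y = J.mul x y := rfl

lemma continuous_mul (J : EuclideanJordanAlgebra E) :
    Continuous fun p : E × E => J.mul p.1 p.2 := by
  simp only [← mulL_apply]; fun_prop

@[fun_prop]
lemma _root_.Continuous.jordan_mul {X : Type*} [TopologicalSpace X] {J : EuclideanJordanAlgebra E}
    {f g : X → E} (hf : Continuous f) (hg : Continuous g) :
    Continuous fun x => J.mul (f x) (g x) :=
  J.continuous_mul.comp (hf.prodMk hg)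

@[fun_prop]
lemma _root_.Continuous.jordan_P {X : Type*} [TopologicalSpace X] {J : EuclideanJordanAlgebra E}
    {f g : X → E} (hf : Continuous f) (hg : Continuous g) :
    Continuous fun x => J.P (f x) (g x) := by
  simp only [P_self]; fun_prop

lemma norm_mul_le (J : EuclideanJordanAlgebra E) (x y : E) :
    ‖J.mul x y‖ ≤ ‖J.mulL‖ * ‖x‖ * ‖y‖ := J.mulL.le_opNorm₂ x y

/-! ### The symmetric cone -/

/-- The set of Jordan squares. -/
def squares (J : EuclideanJordanAlgebra E) : Set E := {z | ∃ x, z = J.mul x x}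

/-- Self-duality of the closed cone. It makes closure under addition evident, which is not visible
from the definition by squares. -/
lemma mem_squares_iff {J : EuclideanJordanAlgebra E} {z : E} :
    z ∈ J.squares ↔ ∀ y, 0 ≤ inner ℝ z (J.mul y y) := by
  constructor
  · rintro ⟨x, rfl⟩ y
    obtain ⟨r, c, l, hc, rfl⟩ := J.exists_frame x
    rw [hc.isSystem.mul_sum, sum_inner]
    refine Finset.sum_nonneg fun i _ => ?_
    rw [inner_smul_left, J.inner_sq]
    exact mul_nonneg (mul_self_nonneg _) (J.idem_mul_nonneg (hc.isSystem.idem i) y)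
  · intro h
    obtain ⟨r, c, l, hc, rfl⟩ := J.exists_frame z
    have hl : ∀ i, 0 ≤ l i := by
      intro i
      have := h (c i)
      rw [hc.isSystem.idem, hc.isSystem.inner_single] at this
      have hp : 0 < ‖c i‖ ^ 2 := by have := norm_pos_iff.2 (hc.ne_zero i); positivity
      exact nonneg_of_mul_nonneg_left this hp
    refine ⟨∑ i, √(l i) • c i, ?_⟩
    rw [hc.isSystem.mul_sum]
    exact Finset.sum_congr rfl fun i _ => by rw [Real.mul_self_sqrt (hl i)]

lemma add_mem_squares {J : EuclideanJordanAlgebra E} {x y : E} (hx : x ∈ J.squares)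
    (hy : y ∈ J.squares) : x + y ∈ J.squares := by
  rw [mem_squares_iff] at *
  intro z
  rw [inner_add_left]
  exact add_nonneg (hx z) (hy z)

lemma smul_mem_squares {J : EuclideanJordanAlgebra E} {x : E} {t : ℝ} (ht : 0 ≤ t)
    (hx : x ∈ J.squares) : t • x ∈ J.squares := by
  rw [mem_squares_iff] at *
  intro z
  rw [inner_smul_left]
  exact mul_nonneg ht (hx z)

lemma inner_squares_nonneg {J : EuclideanJordanAlgebra E} {x y : E} (hx : x ∈ J.squares)
    (hy : y ∈ J.squares) : 0 ≤ inner ℝ x y := by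
  obtain ⟨z, rfl⟩ := hy
  exact mem_squares_iff.1 hx z

lemma idem_mem_squares {J : EuclideanJordanAlgebra E} {c : E} (hc : J.mul c c = c) :
    c ∈ J.squares := ⟨c, hc.symm⟩

lemma mem_squares_of_inner_idem {J : EuclideanJordanAlgebra E} {z : E}
    (h : ∀ c, J.IsPrimitive c → 0 ≤ inner ℝ z c) : z ∈ J.squares := by
  obtain ⟨r, c, l, hc, rfl⟩ := J.exists_frame z
  have hl : ∀ i, 0 ≤ l i := by
    intro i
    have := h (c i) (hc.1 i)
    rw [hc.isSystem.inner_single] at this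
    have hp : 0 < ‖c i‖ ^ 2 := by have := norm_pos_iff.2 (hc.ne_zero i); positivity
    exact nonneg_of_mul_nonneg_left this hp
  refine ⟨∑ i, √(l i) • c i, ?_⟩
  rw [hc.isSystem.mul_sum]
  exact Finset.sum_congr rfl fun i _ => by rw [Real.mul_self_sqrt (hl i)]

lemma e_add_mem_squares {J : EuclideanJordanAlgebra E} {z : E} (hz : ‖J.mulL‖ * ‖z‖ ≤ 1) :
    J.e + z ∈ J.squares := by
  rw [mem_squares_iff]
  intro y
  rw [J.inner_sq, map_add, LinearMap.add_apply, J.e_mul, inner_add_left,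
    real_inner_self_eq_norm_sq]
  have h1 := (abs_le.1 (abs_real_inner_le_norm (J.mul z y) y)).1
  have h2 := J.norm_mul_le z y
  have h3 : ‖J.mul z y‖ * ‖y‖ ≤ ‖y‖ ^ 2 := by
    have := mul_le_mul_of_nonneg_right h2 (norm_nonneg y)
    have h4 := mul_le_mul_of_nonneg_right hz (sq_nonneg ‖y‖)
    nlinarith
  linarith

/-- The neutral element is an order unit, because L(e + z) = 1 + L(z) stays positive for small z.
This describes the interior without choosing a frame. -/
lemma mem_cone_iff {J : EuclideanJordanAlgebra E} {x : E} :
    x ∈ J.cone ↔ ∃ ε : ℝ, 0 < ε ∧ x - ε • J.e ∈ J.squares := by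
  constructor
  · intro hx
    have ht : Tendsto (fun ε : ℝ => x - ε • J.e) (𝓝 0) (𝓝 (x - (0 : ℝ) • J.e)) :=
      Continuous.tendsto (by fun_prop) 0
    rw [zero_smul, sub_zero] at ht
    have h1 : ∀ᶠ ε in 𝓝[>] (0 : ℝ), x - ε • J.e ∈ J.squares :=
      (ht.eventually (mem_interior_iff_mem_nhds.1 hx)).filter_mono nhdsWithin_le_nhds
    obtain ⟨ε, h, hε⟩ := (h1.and self_mem_nhdsWithin).exists
    exact ⟨ε, hε, h⟩
  · rintro ⟨ε, hε, h⟩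
    rw [cone, mem_interior_iff_mem_nhds, Metric.mem_nhds_iff]
    refine ⟨ε / (‖J.mulL‖ + 1), by positivity, fun y hy => ?_⟩
    have hy' : ‖y - x‖ < ε / (‖J.mulL‖ + 1) := by simpa [dist_eq_norm] using hy
    have e1 : y = (x - ε • J.e) + ε • (J.e + ε⁻¹ • (y - x)) := by
      rw [smul_add, smul_inv_smul₀ hε.ne']; abel
    rw [e1]
    refine add_mem_squares h (smul_mem_squares hε.le (e_add_mem_squares ?_))
    rw [norm_smul, Real.norm_eq_abs, abs_of_pos (inv_pos.2 hε)]
    rw [lt_div_iff₀ (by positivity)] at hy'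
    have : ‖J.mulL‖ * (ε⁻¹ * ‖y - x‖) = (‖y - x‖ * ‖J.mulL‖) / ε := by field_simp
    rw [this, div_le_one hε]
    nlinarith [norm_nonneg (y - x)]

lemma isOpen_cone (J : EuclideanJordanAlgebra E) : IsOpen J.cone := isOpen_interior

lemma cone_subset_squares {J : EuclideanJordanAlgebra E} {x : E} (hx : x ∈ J.cone) :
    x ∈ J.squares := interior_subset hx

lemma add_squares_mem_cone {J : EuclideanJordanAlgebra E} {x y : E} (hx : x ∈ J.cone)
    (hy : y ∈ J.squares) : x + y ∈ J.cone := by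
  rw [mem_cone_iff] at *
  obtain ⟨ε, hε, h⟩ := hx
  refine ⟨ε, hε, ?_⟩
  rw [add_sub_right_comm]
  exact add_mem_squares h hy

lemma add_mem_cone {J : EuclideanJordanAlgebra E} {x y : E} (hx : x ∈ J.cone)
    (hy : y ∈ J.cone) : x + y ∈ J.cone := add_squares_mem_cone hx (cone_subset_squares hy)

lemma smul_mem_cone {J : EuclideanJordanAlgebra E} {x : E} {t : ℝ} (ht : 0 < t)
    (hx : x ∈ J.cone) : t • x ∈ J.cone := by
  rw [mem_cone_iff] at *
  obtain ⟨ε, hε, h⟩ := hx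
  refine ⟨t * ε, by positivity, ?_⟩
  rw [mul_smul, ← smul_sub]
  exact smul_mem_squares ht.le h

lemma e_mem_cone (J : EuclideanJordanAlgebra E) : J.e ∈ J.cone := by
  rw [mem_cone_iff]
  refine ⟨1, one_pos, ?_⟩
  rw [one_smul, sub_self]
  exact ⟨0, by simp⟩

lemma smul_e_sub_mem_cone (J : EuclideanJordanAlgebra E) {x : E} {t : ℝ}
    (ht : ‖J.mulL‖ * ‖x‖ < t) : t • J.e - x ∈ J.cone := by
  have h0 : 0 ≤ ‖J.mulL‖ * ‖x‖ := by positivity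
  set m := ‖J.mulL‖ * ‖x‖
  set s := (m + t) / 2
  have hs : 0 < s := by simp only [s]; linarith
  rw [mem_cone_iff]
  refine ⟨t - s, by simp only [s]; linarith, ?_⟩
  have : t • J.e - x - (t - s) • J.e = s • (J.e + s⁻¹ • (-x)) := by
    rw [smul_add, smul_inv_smul₀ hs.ne']; module
  rw [this]
  refine smul_mem_squares hs.le (e_add_mem_squares ?_)
  rw [norm_smul, norm_neg, Real.norm_eq_abs, abs_of_pos (inv_pos.2 hs)]
  have : ‖J.mulL‖ * (s⁻¹ * ‖x‖) = m / s := by simp only [m]; field_simp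
  rw [this, div_le_one hs]
  simp only [s]; linarith

lemma IsSystem.mem_cone {J : EuclideanJordanAlgebra E} {ι : Type*} [Fintype ι] {c : ι → E}
    (hc : J.IsSystem c) {l : ι → ℝ} (hl : ∀ i, 0 < l i) : ∑ i, l i • c i ∈ J.cone := by
  obtain ⟨ε, hε, h⟩ : ∃ ε : ℝ, 0 < ε ∧ ∀ i, ε ≤ l i := by
    rcases isEmpty_or_nonempty ι with hι | hι
    · exact ⟨1, one_pos, fun i => isEmptyElim i⟩
    · obtain ⟨i0, h0⟩ := Finite.exists_min l
      exact ⟨l i0, hl i0, h0⟩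
  rw [mem_cone_iff]
  refine ⟨ε, hε, ∑ i, √(l i - ε) • c i, ?_⟩
  rw [hc.mul_sum, hc.smul_e, ← Finset.sum_sub_distrib]
  refine Finset.sum_congr rfl fun i _ => ?_
  rw [Real.mul_self_sqrt (sub_nonneg.2 (h i)), sub_smul]

lemma IsFrame.mem_cone_iff {J : EuclideanJordanAlgebra E} {r : ℕ} {c : Fin r → E}
    (hc : J.IsFrame c) {l : Fin r → ℝ} : ∑ i, l i • c i ∈ J.cone ↔ ∀ i, 0 < l i := by
  refine ⟨fun h i => ?_, hc.isSystem.mem_cone⟩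
  obtain ⟨ε, hε, h⟩ := EuclideanJordanAlgebra.mem_cone_iff.1 h
  have h1 := inner_squares_nonneg h (idem_mem_squares (hc.isSystem.idem i))
  rw [hc.isSystem.smul_e, ← Finset.sum_sub_distrib] at h1
  simp only [← sub_smul] at h1
  rw [hc.isSystem.inner_single] at h1
  have hp : 0 < ‖c i‖ ^ 2 := by have := norm_pos_iff.2 (hc.ne_zero i); positivity
  have := nonneg_of_mul_nonneg_left h1 hp
  linarith

lemma IsFrame.mem_D_iff {J : EuclideanJordanAlgebra E} {r : ℕ} {c : Fin r → E}
    (hc : J.IsFrame c) {l : Fin r → ℝ} :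
    ∑ i, l i • c i ∈ J.D ↔ ∀ i, 0 < l i ∧ l i < 1 := by
  rw [D, Set.mem_ofPred_eq, hc.isSystem.e_sub, hc.mem_cone_iff, hc.mem_cone_iff, forall_and]
  simp only [sub_pos]

lemma cone_mul_pos {J : EuclideanJordanAlgebra E} {x y : E} (hx : x ∈ J.cone) (hy : y ≠ 0) :
    0 < inner ℝ (J.mul x y) y := by
  obtain ⟨ε, hε, h⟩ := mem_cone_iff.1 hx
  have h1 := mem_squares_iff.1 h y
  rw [J.inner_sq, map_sub, map_smul, LinearMap.sub_apply, LinearMap.smul_apply, J.e_mul,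
    inner_sub_left, inner_smul_left, real_inner_self_eq_norm_sq] at h1
  have : 0 < ‖y‖ ^ 2 := by have := norm_pos_iff.2 hy; positivity
  have := mul_pos hε this
  simp only [conj_trivial] at h1
  linarith

/-- The factorization (x + y)(x - y) = x² - y² = 0 contradicts positive definiteness of L(x + y)
unless x = y. -/
lemma sqrt_unique {J : EuclideanJordanAlgebra E} {x y : E} (hx : x ∈ J.cone) (hy : y ∈ J.cone)
    (h : J.mul x x = J.mul y y) : x = y := by
  by_contra hne
  have h1 := cone_mul_pos (add_mem_cone hx hy) (sub_ne_zero.2 hne)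
  have h2 : J.mul (x + y) (x - y) = 0 := by
    simp only [map_add, map_sub, LinearMap.add_apply, J.mul_comm y x, h]; abel
  rw [h2, inner_zero_left] at h1
  exact lt_irrefl _ h1

lemma sqrt_mul_self {J : EuclideanJordanAlgebra E} {y : E} (hy : y ∈ J.cone) :
    J.sqrt (J.mul y y) = y := by
  have hex : ∃ z ∈ J.cone, J.mul z z = J.mul y y := ⟨y, hy, rfl⟩
  rw [sqrt, dif_pos hex]
  exact sqrt_unique hex.choose_spec.1 hy hex.choose_spec.2

lemma IsSystem.sqrt_sum {J : EuclideanJordanAlgebra E} {ι : Type*} [Fintype ι] {c : ι → E}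
    (hc : J.IsSystem c) {l : ι → ℝ} (hl : ∀ i, 0 < l i) :
    J.sqrt (∑ i, l i • c i) = ∑ i, √(l i) • c i := by
  rw [← sqrt_mul_self (hc.mem_cone fun i => Real.sqrt_pos.2 (hl i)), hc.mul_sum]
  congr 1
  exact Finset.sum_congr rfl fun i _ => by rw [Real.mul_self_sqrt (hl i).le]

/-! ### Peirce weights and the quadratic representation -/

/-- `y` is a joint eigenvector of the operators `L(c i)`, with eigenvalues `p i`. -/
def HasWeight (J : EuclideanJordanAlgebra E) {ι : Type*} (c : ι → E) (p : ι → ℝ) (y : E) : Prop :=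
  ∀ i, J.mul (c i) y = p i • y

section System

variable {J : EuclideanJordanAlgebra E} {ι : Type*} [Fintype ι] {c : ι → E}

lemma IsSystem.weight_induction (hc : J.IsSystem c) {C : E → Prop} (h0 : C 0)
    (hadd : ∀ x y, C x → C y → C (x + y)) (hw : ∀ p y, J.HasWeight c p y → C y) (y : E) : C y := by
  have := J.finiteDimensional
  have htop := LinearMap.IsSymmetric.iSup_iInf_eq_top_of_commute
    (T := fun i => J.mul (c i)) (fun i => J.mul_symm (c i)) (fun i j _ => hc.commute i j)
  have hy : y ∈ ⨆ χ : ι → ℝ, ⨅ i, Module.End.eigenspace (J.mul (c i)) (χ i) := by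
    rw [htop]; trivial
  induction hy using Submodule.iSup_induction' with
  | mem p y hy =>
    refine hw p y fun i => ?_
    rw [Submodule.mem_iInf] at hy
    exact Module.End.mem_eigenspace_iff.1 (hy i)
  | zero => exact h0
  | add x y _ _ hx hy => exact hadd x y hx hy

/-- The eigenvalue of `P(∑ v i c i)` on vectors of weight `p`. -/
noncomputable def weightChar (v p : ι → ℝ) : ℝ := Real.exp (2 * ∑ i, p i * Real.log (v i))

lemma weightChar_add (v p q : ι → ℝ) :
    weightChar v (p + q) = weightChar v p * weightChar v q := by
  simp only [weightChar, ← Real.exp_add, ← mul_add, ← Finset.sum_add_distrib, Pi.add_apply,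
    add_mul]

lemma weightChar_inv (v p : ι → ℝ) : weightChar v⁻¹ p * weightChar v p = 1 := by
  simp only [weightChar, ← Real.exp_add, ← mul_add, ← Finset.sum_add_distrib, Pi.inv_apply,
    Real.log_inv]
  simp

lemma HasWeight.mul_sum {p : ι → ℝ} {y : E} (hy : J.HasWeight c p y) (v : ι → ℝ) :
    J.mul (∑ i, v i • c i) y = (∑ i, v i * p i) • y := by
  rw [map_sum, LinearMap.sum_apply, Finset.sum_smul]
  refine Finset.sum_congr rfl fun i _ => ?_
  rw [map_smul, LinearMap.smul_apply, hy i, smul_smul]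

/-- The weights of a nonzero vector lie in {0, 1/2, 1} and sum to 1, so either one weight is 1 or
exactly two are 1/2. The eigenvalue of P is then v i ² or v i * v k. Written as an exponential it is
multiplicative in the weight, which the fundamental formula exploits. -/
lemma IsSystem.P_weight (hc : J.IsSystem c) {v : ι → ℝ} (hv : ∀ i, 0 < v i) {p : ι → ℝ} {y : E}
    (hy : J.HasWeight c p y) : J.P (∑ i, v i • c i) y = weightChar v p • y := by
  classical
  by_cases h0 : y = 0
  · simp [h0]
  rw [P_self, hc.mul_sum, hy.mul_sum, map_smul, hy.mul_sum, hy.mul_sum, smul_smul, smul_smul,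
    ← sub_smul]
  congr 1
  have hp : ∀ i, p i = 0 ∨ p i = 1 / 2 ∨ p i = 1 := fun i => J.idem_weight (hc.idem i) (hy i) h0
  have hs : ∑ i, p i = 1 := by
    have : (∑ i, p i) • y = (1 : ℝ) • y := by
      rw [Finset.sum_smul, one_smul]
      simp only [← hy _]
      rw [← LinearMap.sum_apply, ← map_sum, hc.sum_eq, J.e_mul]
    exact smul_left_injective ℝ h0 this
  have hp0 : ∀ i, 0 ≤ p i := fun i => by rcases hp i with h | h | h <;> rw [h] <;> norm_num
  obtain ⟨i, hi⟩ : ∃ i, p i ≠ 0 := by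
    by_contra! h
    simp [h] at hs
  by_cases hi1 : p i = 1
  · have hz : ∀ j ≠ i, p j = 0 := by
      have : ∑ j ∈ Finset.univ.erase i, p j = 0 := by
        have := Finset.add_sum_erase Finset.univ p (Finset.mem_univ i)
        rw [hs, hi1] at this; linarith
      intro j hj
      exact (Finset.sum_eq_zero_iff_of_nonneg fun k _ => hp0 k).1 this j
        (Finset.mem_erase.2 ⟨hj, Finset.mem_univ _⟩)
    have hsum : ∀ g : ι → ℝ, ∑ j, g j * p j = g i := by
      intro g
      rw [Finset.sum_eq_single i]
      · rw [hi1, mul_one]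
      · intro j _ hj; rw [hz j hj, mul_zero]
      · simp
    have hsum' : ∑ j, p j * Real.log (v j) = Real.log (v i) := by
      simp only [_root_.mul_comm (p _)]; exact hsum fun j => Real.log (v j)
    rw [hsum, hsum (fun j => v j * v j), weightChar, hsum', two_mul (Real.log _), Real.exp_add,
      Real.exp_log (hv i)]
    ring
  · have hi2 : p i = 1 / 2 := by
      rcases hp i with h | h | h
      · exact absurd h hi
      · exact h
      · exact absurd h hi1
    have he : ∑ j ∈ Finset.univ.erase i, p j = 1 / 2 := by
      have := Finset.add_sum_erase Finset.univ p (Finset.mem_univ i)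
      rw [hs, hi2] at this; linarith
    obtain ⟨k, hk, hkp⟩ : ∃ k ∈ Finset.univ.erase i, p k ≠ 0 := by
      by_contra! h
      rw [Finset.sum_eq_zero h] at he; norm_num at he
    have hki : k ≠ i := (Finset.mem_erase.1 hk).1
    have hk2 : p k = 1 / 2 := by
      have := Finset.single_le_sum (f := p) (fun j _ => hp0 j) hk
      rcases hp k with h | h | h
      · exact absurd h hkp
      · exact h
      · rw [he, h] at this; norm_num at this
    have hz : ∀ j, j ≠ i ∧ j ≠ k → p j = 0 := by
      have h2 := Finset.add_sum_erase (Finset.univ.erase i) p hk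
      rw [he, hk2] at h2
      have h3 : ∑ j ∈ (Finset.univ.erase i).erase k, p j = 0 := by linarith
      rintro j ⟨hj, hj'⟩
      exact (Finset.sum_eq_zero_iff_of_nonneg fun m _ => hp0 m).1 h3 j
        (Finset.mem_erase.2 ⟨hj', Finset.mem_erase.2 ⟨hj, Finset.mem_univ _⟩⟩)
    have hsum : ∀ g : ι → ℝ, ∑ j, g j * p j = (g i + g k) / 2 := by
      intro g
      rw [Finset.sum_eq_add i k hki.symm]
      · rw [hi2, hk2]; ring
      · intro j _ hj; rw [hz j hj, mul_zero]
      · simp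
      · simp
    have hsum' : ∑ j, p j * Real.log (v j) = (Real.log (v i) + Real.log (v k)) / 2 := by
      simp only [_root_.mul_comm (p _)]; exact hsum fun j => Real.log (v j)
    rw [hsum, hsum (fun j => v j * v j), weightChar, hsum',
      mul_div_cancel₀ (Real.log (v i) + Real.log (v k)) (two_ne_zero (α := ℝ)), Real.exp_add,
      Real.exp_log (hv i), Real.exp_log (hv k)]
    ring

lemma IsSystem.P_inv_P (hc : J.IsSystem c) {v : ι → ℝ} (hv : ∀ i, 0 < v i) (y : E) :
    J.P (∑ i, (v i)⁻¹ • c i) (J.P (∑ i, v i • c i) y) = y := by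
  induction y using hc.weight_induction with
  | h0 => simp
  | hadd x y hx hy => rw [map_add, map_add, hx, hy]
  | hw p y hy =>
    have h1 := hc.P_weight (v := v⁻¹) (fun i => inv_pos.2 (hv i)) hy
    simp only [Pi.inv_apply] at h1
    rw [hc.P_weight hv hy, map_smul, h1, smul_smul, _root_.mul_comm, weightChar_inv, one_smul]

lemma IsSystem.P_P_inv (hc : J.IsSystem c) {v : ι → ℝ} (hv : ∀ i, 0 < v i) (y : E) :
    J.P (∑ i, v i • c i) (J.P (∑ i, (v i)⁻¹ • c i) y) = y := by
  have := hc.P_inv_P (v := v⁻¹) (fun i => inv_pos.2 (hv i)) y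
  simpa using this

lemma IsSystem.g₁_sum (hc : J.IsSystem c) {l : ι → ℝ} (hl : ∀ i, 0 < l i) :
    J.g₁ (∑ i, l i • c i) = J.P (∑ i, (√(l i))⁻¹ • c i) := by
  have hs : ∀ i, 0 < √(l i) := fun i => Real.sqrt_pos.2 (hl i)
  rw [g₁, w₁, hc.sqrt_sum hl]
  let u : (Module.End ℝ E)ˣ := 
    ⟨J.P (∑ i, √(l i) • c i), J.P (∑ i, (√(l i))⁻¹ • c i),
      LinearMap.ext fun y => hc.P_P_inv hs y, LinearMap.ext fun y => hc.P_inv_P hs y⟩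
  exact Ring.inverse_unit u

/-- Polarization of the quadratic representation. -/
noncomputable def polarP (J : EuclideanJordanAlgebra E) (y z w : E) : E :=
  J.mul y (J.mul z w) + J.mul z (J.mul y w) - J.mul (J.mul y z) w

lemma polarP_self (y w : E) : J.polarP y y w = J.P y w := by
  rw [polarP, P_self]; module

omit [Fintype ι] in
-- Polarizing `mul_P_add_P_mul` gives L(a)P(y,z) + P(y,z)L(a) = P(ay,z) + P(y,az), so weights add,
-- with that of w subtracted.
lemma HasWeight.polarP {p q o : ι → ℝ} {y z w : E} (hy : J.HasWeight c p y)
    (hz : J.HasWeight c q z) (hw : J.HasWeight c o w) :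
    J.HasWeight c (p + q - o) (J.polarP y z w) := by
  intro i
  have h1 := J.mul_P_add_P_mul (c i) (y + z) w
  have h2 := J.mul_P_add_P_mul (c i) y w
  have h3 := J.mul_P_add_P_mul (c i) z w
  simp only [P_self, map_add, map_sub, map_smul, LinearMap.add_apply, LinearMap.smul_apply,
    hy i, hz i, hw i, J.mul_comm z y] at h1 h2 h3
  simp only [EuclideanJordanAlgebra.polarP, map_add, map_sub, Pi.add_apply, Pi.sub_apply]
  linear_combination (norm := module) (1 / 2 : ℝ) • (h1 - h2 - h3)

/-- The fundamental formula, polarized, for elements of the cone. -/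
lemma IsSystem.polarP_P (hc : J.IsSystem c) {v : ι → ℝ} (hv : ∀ i, 0 < v i) (y z w : E) :
    J.polarP (J.P (∑ i, v i • c i) y) (J.P (∑ i, v i • c i) z) w
      = J.P (∑ i, v i • c i) (J.polarP y z (J.P (∑ i, v i • c i) w)) := by
  set x := ∑ i, v i • c i
  induction y using hc.weight_induction with
  | h0 => simp [polarP]
  | hadd y y' hy hy' =>
    simp only [polarP, map_add, map_sub, LinearMap.add_apply] at hy hy' ⊢
    linear_combination (norm := module) hy + hy'
  | hw p y hy =>
    induction z using hc.weight_induction with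
    | h0 => simp [polarP]
    | hadd z z' hz hz' =>
      simp only [polarP, map_add, map_sub, LinearMap.add_apply] at hz hz' ⊢
      linear_combination (norm := module) hz + hz'
    | hw q z hz =>
      induction w using hc.weight_induction with
      | h0 => simp [polarP]
      | hadd w w' hw hw' =>
        simp only [polarP, map_add, map_sub] at hw hw' ⊢
        linear_combination (norm := module) hw + hw'
      | hw o w hw =>
        rw [hc.P_weight hv hy, hc.P_weight hv hz, hc.P_weight hv hw]
        have h1 : ∀ a b d : ℝ, J.polarP (a • y) (b • z) (d • w) = (a * b * d) • J.polarP y z w := by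
          intro a b d
          simp only [polarP, map_smul, LinearMap.smul_apply]
          module
        have h2 := hc.P_weight hv (hy.polarP hz hw)
        have e1 := h1 (weightChar v p) (weightChar v q) 1
        have e2 := h1 1 1 (weightChar v o)
        simp only [one_smul] at e1 e2
        rw [e1, e2, map_smul, h2, smul_smul]
        congr 1
        -- On weight vectors both sides are multiples of `J.polarP y z w`, and the scalars agree
        -- because the eigenvalue is a character of the weight.
        have h3 : weightChar v (p + q - o) * weightChar v o = weightChar v p * weightChar v q := by
          rw [← weightChar_add, ← weightChar_add, sub_add_cancel]
        linear_combination -h3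

end System

/-- The fundamental formula `P(P(x)y) = P(x)P(y)P(x)` for `x` in the closed cone. -/
lemma fundamental_formula {J : EuclideanJordanAlgebra E} {x : E} (hx : x ∈ J.squares) (y w : E) :
    J.P (J.P x y) w = J.P x (J.P y (J.P x w)) := by
  have hV : ∀ x ∈ J.cone, J.P (J.P x y) w = J.P x (J.P y (J.P x w)) := by
    intro x hx
    obtain ⟨r, c, l, hc, rfl⟩ := J.exists_frame x
    have := hc.isSystem.polarP_P (hc.mem_cone_iff.1 hx) y y w
    rwa [polarP_self, polarP_self] at this
  have ht1 : Tendsto (fun ε : ℝ => J.P (J.P (x + ε • J.e) y) w) (𝓝[>] 0)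
      (𝓝 (J.P (J.P (x + (0 : ℝ) • J.e) y) w)) :=
    (Continuous.tendsto (by fun_prop) 0).mono_left nhdsWithin_le_nhds
  have ht2 : Tendsto (fun ε : ℝ => J.P (x + ε • J.e) (J.P y (J.P (x + ε • J.e) w))) (𝓝[>] 0)
      (𝓝 (J.P (x + (0 : ℝ) • J.e) (J.P y (J.P (x + (0 : ℝ) • J.e) w)))) :=
    (Continuous.tendsto (by fun_prop) 0).mono_left nhdsWithin_le_nhds
  rw [zero_smul, add_zero] at ht1 ht2
  refine tendsto_nhds_unique_of_eventuallyEq ht1 ht2 ?_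
  filter_upwards [self_mem_nhdsWithin] with ε hε
  apply hV
  rw [add_comm]
  exact add_squares_mem_cone (smul_mem_cone hε J.e_mem_cone) hx

/-! ### Primitive idempotents -/

lemma idem_mul_P (J : EuclideanJordanAlgebra E) {c : E} (hc : J.mul c c = c) (x : E) :
    J.mul c (J.P c x) = J.P c x := by
  have h := J.idem_cubic hc x
  rw [P_self, hc, map_sub, map_smul]
  linear_combination (norm := module) h

/-- The Peirce space `E₁(c)` of a primitive idempotent is the line through `c`. -/
lemma IsPrimitive.eq_smul {J : EuclideanJordanAlgebra E} {c z : E} (hc : J.IsPrimitive c)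
    (hz : J.mul c z = z) : ∃ t : ℝ, z = t • c := by
  obtain ⟨r, d, l, hd, hzd⟩ := J.exists_frame z
  have hds := hd.isSystem
  have hcc := hc.1.1
  have h0 : inner ℝ (J.mul z z) (J.e - c) = 0 := by
    rw [← J.inner_mul, map_sub, J.mul_e, J.mul_comm z c, hz, sub_self, inner_zero_right]
  rw [hzd, hds.mul_sum, sum_inner] at h0
  have hnn : ∀ i, 0 ≤ inner ℝ (d i) (J.e - c) := fun i =>
    J.idem_inner_nonneg (hds.idem i) (J.idem_compl hcc)
  have h1 := (Finset.sum_eq_zero_iff_of_nonneg fun i _ => by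
    rw [inner_smul_left]; exact mul_nonneg (mul_self_nonneg _) (hnn i)).1 h0
  -- A spectral idempotent of z with nonzero eigenvalue is orthogonal to e - c, hence lies below c;
  -- primitivity of c leaves no room for c - d i.
  have h2 : ∀ i, l i ≠ 0 → d i = c := by
    intro i hi
    have h3 := h1 i (Finset.mem_univ i)
    rw [inner_smul_left] at h3
    have h4 : inner ℝ (d i) (J.e - c) = 0 :=
      (mul_eq_zero.1 h3).resolve_left (mul_self_ne_zero.2 hi)
    have h5 := J.idem_orthogonal (hds.idem i) (J.idem_compl hcc) h4
    rw [map_sub, J.mul_e, sub_eq_zero] at h5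
    by_contra hne
    refine hc.2 ⟨d i, c - d i, ⟨hds.idem i, hd.ne_zero i⟩, ⟨?_, ?_⟩, by abel⟩
    · simp only [map_sub, LinearMap.sub_apply, hcc, hds.idem i, J.mul_comm c (d i), ← h5]; abel
    · exact sub_ne_zero.2 fun h => hne h.symm
  by_cases hl : ∃ i, l i ≠ 0
  · obtain ⟨i, hi⟩ := hl
    refine ⟨l i, ?_⟩
    rw [hzd, Finset.sum_eq_single i]
    · rw [h2 i hi]
    · intro j _ hj
      by_cases hlj : l j = 0
      · rw [hlj, zero_smul]
      · have := hds.orth i j hj.symm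
        rw [h2 i hi, h2 j hlj, hcc] at this
        exact absurd this hc.1.2
    · simp
  · push Not at hl
    exact ⟨0, by rw [hzd]; simp [hl]⟩

/-- P(c) maps into the Peirce 1-space, which is the line through c; the coefficient comes from P(c)c
= c and symmetry of P(c). -/
lemma IsPrimitive.P_eq {J : EuclideanJordanAlgebra E} {c : E} (hc : J.IsPrimitive c) (x : E) :
    J.P c x = (inner ℝ c x / ‖c‖ ^ 2) • c := by
  obtain ⟨t, ht⟩ := hc.eq_smul (J.idem_mul_P hc.1.1 x)
  rw [ht]
  congr 1
  have hp : 0 < ‖c‖ ^ 2 := by have := norm_pos_iff.2 hc.1.2; positivity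
  have h1 : J.P c c = c := by rw [P_self, hc.1.1, hc.1.1]; module
  have h2 := J.P_symm c c x
  rw [h1, ht, inner_smul_right, real_inner_self_eq_norm_sq] at h2
  rw [h2, mul_div_cancel_right₀ _ hp.ne']

/-- Apply P(P(c)d) = P(c)P(d)P(c) to c: the left side has coefficient (⟨c,d⟩/‖c‖²)², the right side
⟨c,d⟩²/(‖c‖²‖d‖²). -/
lemma IsPrimitive.norm_eq {J : EuclideanJordanAlgebra E} {c d : E} (hc : J.IsPrimitive c)
    (hd : J.IsPrimitive d) (h : inner ℝ c d ≠ 0) : ‖c‖ ^ 2 = ‖d‖ ^ 2 := by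
  have hcp : 0 < ‖c‖ ^ 2 := by have := norm_pos_iff.2 hc.1.2; positivity
  have hdp : 0 < ‖d‖ ^ 2 := by have := norm_pos_iff.2 hd.1.2; positivity
  have h1 := fundamental_formula (idem_mem_squares hc.1.1) d c
  have hcc : J.P c c = c := by rw [P_self, hc.1.1, hc.1.1]; module
  rw [hc.P_eq d, P_smul, LinearMap.smul_apply, hcc, hd.P_eq c, map_smul, hc.P_eq d, smul_smul,
    real_inner_comm c d] at h1
  have h2 := smul_left_injective ℝ hc.1.2 h1
  have h3 : inner ℝ c d / ‖c‖ ^ 2 = inner ℝ c d / ‖d‖ ^ 2 := by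
    apply mul_right_cancel₀ (div_ne_zero h hcp.ne')
    rw [← sq]; exact h2
  rw [div_eq_div_iff hcp.ne' hdp.ne'] at h3
  exact (mul_left_cancel₀ h h3).symm

/-! ### The quadratic representation preserves the cone -/

/-- By symmetry of P(x) and self-duality, it suffices that P(x)c is a square for primitive c. The
fundamental formula gives (P(x)c)² = P(x)P(c)x² = β P(x)c with β ≥ 0, so P(x)c is zero or a positive
multiple of a square. -/
lemma P_mem_squares {J : EuclideanJordanAlgebra E} {x z : E} (hx : x ∈ J.squares)
    (hz : z ∈ J.squares) : J.P x z ∈ J.squares := by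
  apply mem_squares_of_inner_idem
  intro c hc
  rw [J.P_symm]
  apply inner_squares_nonneg hz
  have hp : 0 < ‖c‖ ^ 2 := by have := norm_pos_iff.2 hc.1.2; positivity
  set β := inner ℝ c (J.mul x x) / ‖c‖ ^ 2
  have hβ : 0 ≤ β := div_nonneg (by
    rw [J.inner_sq]; exact J.idem_mul_nonneg hc.1.1 x) hp.le
  have h1 : J.mul (J.P x c) (J.P x c) = β • J.P x c := by
    rw [← J.P_apply_e, fundamental_formula hx, J.P_apply_e, hc.P_eq, map_smul]
  rcases hβ.eq_or_lt with h | h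
  · rw [← h, zero_smul] at h1
    have : J.P x c = 0 := by
      have h2 := J.inner_sq J.e (J.P x c)
      rw [h1, inner_zero_right, J.e_mul] at h2
      exact inner_self_eq_zero.1 h2.symm
    exact ⟨0, by simp [this]⟩
  · refine ⟨(√β)⁻¹ • J.P x c, ?_⟩
    rw [map_smul, map_smul, LinearMap.smul_apply, h1, smul_smul, smul_smul]
    have : (√β)⁻¹ * (√β)⁻¹ * β = 1 := by
      rw [← mul_inv, Real.mul_self_sqrt h.le, inv_mul_cancel₀ h.ne']
    rw [this, one_smul]

lemma mul_self_mem_cone {J : EuclideanJordanAlgebra E} {x : E} (hx : x ∈ J.cone) :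
    J.mul x x ∈ J.cone := by
  obtain ⟨r, c, l, hc, rfl⟩ := J.exists_frame x
  rw [hc.isSystem.mul_sum, hc.mem_cone_iff]
  intro i
  have := hc.mem_cone_iff.1 hx i
  positivity

lemma P_mem_cone {J : EuclideanJordanAlgebra E} {x z : E} (hx : x ∈ J.cone)
    (hz : z ∈ J.cone) : J.P x z ∈ J.cone := by
  obtain ⟨ε, hε, h⟩ := mem_cone_iff.1 hz
  have : J.P x z = ε • J.mul x x + J.P x (z - ε • J.e) := by
    rw [map_sub, map_smul, J.P_apply_e]; abel
  rw [this]
  exact add_squares_mem_cone (smul_mem_cone hε (mul_self_mem_cone hx))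
    (P_mem_squares (cone_subset_squares hx) h)

end EuclideanJordanAlgebra

namespace InformationEquation

open Filter Topology

/-! ### The equation `F (s / (1 + t)) + G t = H (t / (1 + s)) + K s` on the positive orthant -/

variable {ι : Type*}

/-- The open positive orthant. -/
def Pos (ι : Type*) : Set (ι → ℝ) := {u | ∀ i, 0 < u i}

lemma Pos.mul {u v : ι → ℝ} (hu : u ∈ Pos ι) (hv : v ∈ Pos ι) : u * v ∈ Pos ι :=
  fun i => mul_pos (hu i) (hv i)

lemma Pos.div {u v : ι → ℝ} (hu : u ∈ Pos ι) (hv : v ∈ Pos ι) : u / v ∈ Pos ι :=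
  fun i => div_pos (hu i) (hv i)

lemma Pos.one_add {u : ι → ℝ} (hu : u ∈ Pos ι) : 1 + u ∈ Pos ι :=
  fun i => add_pos one_pos (hu i)

lemma Pos.smul {u : ι → ℝ} {ε : ℝ} (hε : 0 < ε) (hu : u ∈ Pos ι) : ε • u ∈ Pos ι :=
  fun i => mul_pos hε (hu i)

lemma Pos.one : (1 : ι → ℝ) ∈ Pos ι := fun _ => one_pos

lemma isOpen_Pos [Finite ι] : IsOpen (Pos ι) := by
  have : Pos ι = ⋂ i, {u : ι → ℝ | 0 < u i} := by ext; simp [Pos]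
  rw [this]
  exact isOpen_iInter_of_finite fun i => isOpen_lt continuous_const (continuous_apply i)

lemma tendsto_div {α : Type*} {l : Filter α} {a b : α → ι → ℝ} {x y : ι → ℝ}
    (ha : Tendsto a l (𝓝 x)) (hb : Tendsto b l (𝓝 y)) (hy : y ∈ Pos ι) :
    Tendsto (fun ε => a ε / b ε) l (𝓝 (x / y)) :=
  tendsto_pi_nhds.2 fun i => (tendsto_pi_nhds.1 ha i).div (tendsto_pi_nhds.1 hb i) (hy i).ne'

/-! ### Cauchy equations on the positive orthant. -/

section

variable [Fintype ι]

/-- The functional `∑ i, δ i * log (u i)`. -/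
noncomputable def logSum (δ u : ι → ℝ) : ℝ := ∑ i, δ i * Real.log (u i)

lemma logSum_mul (δ : ι → ℝ) {u v : ι → ℝ} (hu : u ∈ Pos ι) (hv : v ∈ Pos ι) :
    logSum δ (u * v) = logSum δ u + logSum δ v := by
  simp only [logSum, ← Finset.sum_add_distrib]
  refine Finset.sum_congr rfl fun i _ => ?_
  rw [Pi.mul_apply, Real.log_mul (hu i).ne' (hv i).ne']; ring

lemma logSum_div (δ : ι → ℝ) {u v : ι → ℝ} (hu : u ∈ Pos ι) (hv : v ∈ Pos ι) :
    logSum δ (u / v) = logSum δ u - logSum δ v := by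
  simp only [logSum, ← Finset.sum_sub_distrib]
  refine Finset.sum_congr rfl fun i _ => ?_
  rw [Pi.div_apply, Real.log_div (hu i).ne' (hv i).ne']; ring

lemma logSum_one (δ : ι → ℝ) : logSum δ 1 = 0 := by simp [logSum]

lemma continuousOn_logSum (δ : ι → ℝ) : ContinuousOn (logSum δ) (Pos ι) := by
  unfold logSum
  refine continuousOn_finsetSum _ fun i _ => ?_
  exact continuousOn_const.mul ((continuous_apply i).continuousOn.log fun u hu => (hu i).ne')

lemma neg_logSum (δ u : ι → ℝ) : logSum (-δ) u = -logSum δ u := by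
  simp only [logSum, ← Finset.sum_neg_distrib, Pi.neg_apply, neg_mul]

/-- A continuous additive function on the positive orthant is linear. -/
lemma exists_linear_of_additive {θ : (ι → ℝ) → ℝ} (hc : ContinuousOn θ (Pos ι))
    (hadd : ∀ a ∈ Pos ι, ∀ b ∈ Pos ι, θ (a + b) = θ a + θ b) :
    ∃ δ : ι → ℝ, ∀ a ∈ Pos ι, θ a = ∑ i, δ i * a i := by
  classical
  -- z = p z - p (-z) writes z as a difference of positive vectors (the summand 1 keeps them
  -- strictly positive), so θ extends to an additive function Θ on the whole space.
  let p : (ι → ℝ) → ι → ℝ := fun z i => max (z i) 0 + 1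
  have hp : ∀ z, p z ∈ Pos ι := fun z i => by positivity
  have hpc : Continuous p := by fun_prop
  let Θ : (ι → ℝ) → ℝ := fun z => θ (p z) - θ (p (-z))
  have hΘ : ∀ a ∈ Pos ι, ∀ b ∈ Pos ι, Θ (a - b) = θ a - θ b := by
    intro a ha b hb
    have h1 : p (a - b) + b = p (-(a - b)) + a := by
      ext i
      simp only [p, Pi.add_apply, Pi.sub_apply, Pi.neg_apply]
      rcases le_total (a i) (b i) with h | h
      · rw [max_eq_right (by linarith), max_eq_left (by linarith)]; ring
      · rw [max_eq_left (by linarith), max_eq_right (by linarith)]; ring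
    have h2 := congrArg θ h1
    rw [hadd _ (hp _) _ hb, hadd _ (hp _) _ ha] at h2
    simp only [Θ]; linarith
  have hdec : ∀ z, z = p z - p (-z) := by
    intro z; ext i
    simp only [p, Pi.sub_apply, Pi.neg_apply]
    rcases le_total (z i) 0 with h | h
    · rw [max_eq_right h, max_eq_left (by linarith)]; ring
    · rw [max_eq_left h, max_eq_right (by linarith)]; ring
  have hΘadd : ∀ z w, Θ (z + w) = Θ z + Θ w := by
    intro z w
    have : z + w = (p z + p w) - (p (-z) + p (-w)) := by
      nth_rewrite 1 [hdec z, hdec w]; abel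
    have hpp : ∀ u v, p u + p v ∈ Pos ι := fun u v i => add_pos (hp u i) (hp v i)
    rw [this, hΘ _ (hpp _ _) _ (hpp _ _), hadd _ (hp _) _ (hp _), hadd _ (hp _) _ (hp _)]
    simp only [Θ]; ring
  have hθp : Continuous fun z => θ (p z) := hc.comp_continuous hpc hp
  have hΘc : Continuous Θ := hθp.sub (hθp.comp continuous_neg)
  let T : (ι → ℝ) →L[ℝ] ℝ := (AddMonoidHom.mk' Θ hΘadd).toRealLinearMap hΘc
  refine ⟨fun i => T (fun j => if i = j then 1 else 0), fun a ha => ?_⟩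
  have h1 := LinearMap.pi_apply_eq_sum_univ (T : (ι → ℝ) →ₗ[ℝ] ℝ) a
  have h2 : T a = θ a := by
    have e : a = (a + a) - a := by abel
    change Θ a = θ a
    nth_rewrite 1 [e]
    rw [hΘ (a + a) (fun i => add_pos (ha i) (ha i)) a ha, hadd _ ha _ ha]; ring
  rw [← h2]
  simpa [_root_.mul_comm] using h1

/-- The hypothesis makes τ(m) = Δ(mp) - Δ(p) independent of p, hence multiplicative-to-additive;
after exponentiating coordinates it is a Cauchy equation. The domain p > 1 is that of p = 1 + t. -/
lemma exists_logSum_of_one_lt {Δ : (ι → ℝ) → ℝ} (hc : ContinuousOn Δ {p | ∀ i, 1 < p i})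
    (h : ∀ m p p' : ι → ℝ, (∀ i, 1 < m i) → (∀ i, 1 < p i) → (∀ i, 1 < p' i) →
      Δ (m * p) - Δ (m * p') = Δ p - Δ p') :
    ∃ (δ : ι → ℝ) (C : ℝ), ∀ p : ι → ℝ, (∀ i, 1 < p i) → Δ p = logSum δ p + C := by
  let q : ι → ℝ := fun _ => 2
  have hq : ∀ i, 1 < q i := fun _ => one_lt_two
  let τ : (ι → ℝ) → ℝ := fun m => Δ (m * q) - Δ q
  have hmul : ∀ {m p : ι → ℝ}, (∀ i, 1 < m i) → (∀ i, 1 < p i) → ∀ i, 1 < (m * p) i :=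
    fun hm hp i => one_lt_mul_of_lt_of_le (hm i) (hp i).le
  have hτ : ∀ m p, (∀ i, 1 < m i) → (∀ i, 1 < p i) → Δ (m * p) - Δ p = τ m := by
    intro m p hm hp
    have := h m p q hm hp hq
    simp only [τ]; linarith
  let E : (ι → ℝ) → ι → ℝ := fun a i => Real.exp (a i)
  have hE : ∀ a ∈ Pos ι, ∀ i, 1 < E a i := fun a ha i => Real.one_lt_exp_iff.2 (ha i)
  have hEc : Continuous E := by fun_prop
  have hθc : ContinuousOn (fun a => τ (E a)) (Pos ι) := by
    refine ContinuousOn.sub ?_ continuousOn_const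
    refine hc.comp (by fun_prop) fun a ha => ?_
    exact hmul (hE a ha) hq
  obtain ⟨δ, hδ⟩ := exists_linear_of_additive hθc (by
    intro a ha b hb
    have e : E (a + b) = E a * E b := by ext i; simp [E, Real.exp_add]
    have h1 := hτ (E a) (E b * q) (hE a ha) (hmul (hE b hb) hq)
    have h2 := hτ (E b) q (hE b hb) hq
    have h3 := hτ (E a * E b) q (hmul (hE a ha) (hE b hb)) hq
    rw [mul_assoc] at h3
    rw [e]; linarith)
  refine ⟨δ, Δ q - τ q, fun p hp => ?_⟩
  have h1 := hτ p q hp hq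
  have h2 := hτ q p hq hp
  rw [_root_.mul_comm] at h2
  have h3 := hδ (fun i => Real.log (p i)) fun i => Real.log_pos (hp i)
  have e : E (fun i => Real.log (p i)) = p := by
    ext i; exact Real.exp_log (by linarith [hp i])
  simp only [e] at h3
  rw [logSum, ← h3]; linarith

lemma exists_logSum {N : (ι → ℝ) → ℝ} (hc : ContinuousOn N (Pos ι))
    (h : ∀ m ∈ Pos ι, ∀ p ∈ Pos ι, ∀ p' ∈ Pos ι, N (m * p) - N (m * p') = N p - N p') :
    ∃ (δ : ι → ℝ) (C : ℝ), ∀ p ∈ Pos ι, N p = logSum δ p + C := by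
  have hpos : ∀ {p : ι → ℝ}, (∀ i, 1 < p i) → p ∈ Pos ι := fun hp i => one_pos.trans (hp i)
  obtain ⟨δ, C, hδ⟩ := exists_logSum_of_one_lt (hc.mono fun p hp => hpos hp)
    fun m p p' hm hp hp' => h m (hpos hm) p (hpos hp) p' (hpos hp')
  refine ⟨δ, C, fun p hp => ?_⟩
  -- Chosen so that both m and m * p exceed 1, moving p into the region already treated.
  let m : ι → ℝ := fun i => 2 / p i + 2
  let q : ι → ℝ := fun _ => 2
  have hq : ∀ i, 1 < q i := fun _ => one_lt_two
  have hm : ∀ i, 1 < m i := fun i => by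
    have : 0 < 2 / p i := div_pos two_pos (hp i)
    simp only [m]; linarith
  have hmp : ∀ i, 1 < (m * p) i := fun i => by
    have : (m * p) i = 2 + 2 * p i := by
      simp only [m, Pi.mul_apply]; have := (hp i).ne'; field_simp
    rw [this]; linarith [hp i]
  have hmq : ∀ i, 1 < (m * q) i := fun i => one_lt_mul_of_lt_of_le (hm i) (hq i).le
  have h1 := h m (hpos hm) p hp q (hpos hq)
  rw [hδ _ hmp, hδ _ hmq, hδ _ hq, logSum_mul _ (hpos hm) hp, logSum_mul _ (hpos hm) (hpos hq)]
    at h1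
  linarith

/-! ### Small arguments: determining H - G and K - F. -/

lemma tendsto_small {F G H K : (ι → ℝ) → ℝ} (hH : ContinuousOn H (Pos ι))
    (heq : ∀ s ∈ Pos ι, ∀ t ∈ Pos ι, F (s / (1 + t)) + G t = H (t / (1 + s)) + K s)
    {s t : ι → ℝ} (hs : s ∈ Pos ι) (ht : t ∈ Pos ι) :
    Tendsto (fun ε : ℝ => F ((ε • s) / (1 + t)) - K (ε • s)) (𝓝[>] 0) (𝓝 (H t - G t)) := by
  have h1 : Tendsto (fun ε : ℝ => t / (1 + ε • s)) (𝓝[>] 0) (𝓝 t) := by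
    have h2 : Tendsto (fun ε : ℝ => 1 + ε • s) (𝓝[>] 0) (𝓝 (1 + (0 : ℝ) • s)) :=
      (Continuous.tendsto (by fun_prop) 0).mono_left nhdsWithin_le_nhds
    rw [zero_smul, add_zero] at h2
    simpa using tendsto_div (tendsto_const_nhds (x := t)) h2 Pos.one
  have h2 := (((hH.continuousAt (isOpen_Pos.mem_nhds ht)).tendsto.comp h1).sub_const (G t))
  refine h2.congr' ?_
  filter_upwards [self_mem_nhdsWithin] with ε hε
  have := heq (ε • s) (Pos.smul hε hs) t ht
  simp only [Function.comp_apply]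
  linarith

/-- By `tendsto_small`, H(t) - G(t) is the limit of F(εs/(1+t)) - K(εs) for every s. In differences
over t the K terms cancel, and dividing s by m amounts to multiplying 1 + t by m, so Δ has
scale-invariant differences. -/
lemma exists_logSum_sub {F G H K : (ι → ℝ) → ℝ} (hG : ContinuousOn G (Pos ι))
    (hH : ContinuousOn H (Pos ι))
    (heq : ∀ s ∈ Pos ι, ∀ t ∈ Pos ι, F (s / (1 + t)) + G t = H (t / (1 + s)) + K s) :
    ∃ (δ : ι → ℝ) (C : ℝ), ∀ t ∈ Pos ι, H t = G t + logSum δ (1 + t) + C := by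
  have hpos : ∀ {p : ι → ℝ}, (∀ i, 1 < p i) → p ∈ Pos ι := fun hp i => one_pos.trans (hp i)
  have hpos' : ∀ {p : ι → ℝ}, (∀ i, 1 < p i) → p - 1 ∈ Pos ι := fun hp i => sub_pos.2 (hp i)
  let Δ : (ι → ℝ) → ℝ := fun p => H (p - 1) - G (p - 1)
  have hlim : ∀ (s p p' : ι → ℝ), s ∈ Pos ι → (∀ i, 1 < p i) → (∀ i, 1 < p' i) →
      Tendsto (fun ε : ℝ => F ((ε • s) / p) - F ((ε • s) / p')) (𝓝[>] 0) (𝓝 (Δ p - Δ p')) := by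
    intro s p p' hs hp hp'
    have h1 := (tendsto_small hH heq hs (hpos' hp)).sub (tendsto_small hH heq hs (hpos' hp'))
    simp only [add_sub_cancel] at h1
    refine h1.congr fun ε => by ring
  obtain ⟨δ, C, h⟩ := exists_logSum_of_one_lt (Δ := Δ) (by
    have hc : ContinuousOn (fun p : ι → ℝ => p - 1) {p | ∀ i, 1 < p i} := by fun_prop
    exact (hH.comp hc fun p hp => hpos' hp).sub (hG.comp hc fun p hp => hpos' hp)) (by
    intro m p p' hm hp hp'
    have h1 := hlim (1 / m) p p' (Pos.div Pos.one (hpos hm)) hp hp'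
    have h2 := hlim 1 (m * p) (m * p') Pos.one
      (fun i => one_lt_mul_of_lt_of_le (hm i) (hp i).le)
      (fun i => one_lt_mul_of_lt_of_le (hm i) (hp' i).le)
    have e : ∀ (ε : ℝ) (q : ι → ℝ), (ε • (1 / m)) / q = (ε • (1 : ι → ℝ)) / (m * q) := by
      intro ε q; ext i; simp [div_eq_mul_inv, _root_.mul_comm, mul_assoc]
    simp only [e] at h1
    exact tendsto_nhds_unique h2 h1)
  refine ⟨δ, C, fun t ht => ?_⟩
  have := h (1 + t) fun i => by simpa using ht i
  simp only [Δ, add_sub_cancel_left] at this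
  linarith

/-! ### The equation with only two unknown functions. -/

section Reduced

variable {F G : (ι → ℝ) → ℝ}

/-- F(εs/(1+t)) - F(εs) tends to c for all s and t; dividing by 2 twice is dividing by 4 once, so 2c
= c. -/
lemma eq_zero_of_reduced {c : ℝ} (hG : ContinuousOn G (Pos ι))
    (heq : ∀ s ∈ Pos ι, ∀ t ∈ Pos ι, F (s / (1 + t)) - F s = G (t / (1 + s)) - G t + c) :
    c = 0 := by
  have hlim : ∀ (s t : ι → ℝ), s ∈ Pos ι → t ∈ Pos ι →
      Tendsto (fun ε : ℝ => F ((ε • s) / (1 + t)) - F (ε • s)) (𝓝[>] 0) (𝓝 c) := by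
    intro s t hs ht
    have := tendsto_small (F := F) (G := fun t => G t - c) (H := G) (K := F) hG
      (fun s hs t ht => by linarith [heq s hs t ht]) hs ht
    simpa using this
  have h1 := hlim 1 1 Pos.one Pos.one
  have h2 := hlim (1 / (1 + 1)) 1 (Pos.div Pos.one (Pos.one_add Pos.one)) Pos.one
  have h3 := hlim 1 (fun _ => 3) Pos.one fun _ => three_pos
  have e1 : ∀ ε : ℝ, ε • (1 / (1 + 1) : ι → ℝ) = (ε • (1 : ι → ℝ)) / (1 + 1) := by
    intro ε; ext i; simp [div_eq_mul_inv]
  have e2 : ∀ ε : ℝ, (ε • (1 : ι → ℝ)) / (1 + 1) / (1 + 1)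
      = (ε • (1 : ι → ℝ)) / (1 + fun _ => 3) := by
    intro ε; ext i; simp; ring
  simp only [e1, e2] at h2
  have h4 := tendsto_nhds_unique ((h1.add h2).congr fun ε => by ring) h3
  linarith

/-- At s/ε and t/ε the quotients t/(1+s) and s/(1+t) become t/(ε+s) and s/(ε+t), which converge. The
vector s may vary with ε because a later use takes t - ε. -/
lemma tendsto_large (hF : ContinuousOn F (Pos ι)) (hG : ContinuousOn G (Pos ι))
    (heq : ∀ s ∈ Pos ι, ∀ t ∈ Pos ι, F (s / (1 + t)) - F s = G (t / (1 + s)) - G t)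
    {s : ℝ → ι → ℝ} {s₀ t : ι → ℝ} (hs : Tendsto s (𝓝[>] 0) (𝓝 s₀)) (hs₀ : s₀ ∈ Pos ι)
    (ht : t ∈ Pos ι) :
    Tendsto (fun ε : ℝ => G (ε⁻¹ • t) - F (ε⁻¹ • s ε)) (𝓝[>] 0)
      (𝓝 (G (t / s₀) - F (s₀ / t))) := by
  have hε : Tendsto (fun ε : ℝ => ε • (1 : ι → ℝ)) (𝓝[>] 0) (𝓝 0) := by
    have : Tendsto (fun ε : ℝ => ε • (1 : ι → ℝ)) (𝓝[>] 0) (𝓝 ((0 : ℝ) • (1 : ι → ℝ))) :=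
      (Continuous.tendsto (by fun_prop) 0).mono_left nhdsWithin_le_nhds
    rwa [zero_smul] at this
  have a1 : Tendsto (fun ε : ℝ => t / (ε • (1 : ι → ℝ) + s ε)) (𝓝[>] 0) (𝓝 (t / s₀)) := by
    apply tendsto_div tendsto_const_nhds _ hs₀
    simpa using hε.add hs
  have a2 : Tendsto (fun ε : ℝ => s ε / (ε • (1 : ι → ℝ) + t)) (𝓝[>] 0) (𝓝 (s₀ / t)) := by
    apply tendsto_div hs _ ht
    simpa using hε.add_const t
  have b1 := (hG.continuousAt (isOpen_Pos.mem_nhds (Pos.div ht hs₀))).tendsto.comp a1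
  have b2 := (hF.continuousAt (isOpen_Pos.mem_nhds (Pos.div hs₀ ht))).tendsto.comp a2
  refine (b1.sub b2).congr' ?_
  filter_upwards [self_mem_nhdsWithin, hs.eventually (isOpen_Pos.mem_nhds hs₀)] with ε hε hsε
  have h := heq (ε⁻¹ • s ε) (Pos.smul (inv_pos.2 hε) hsε) (ε⁻¹ • t) (Pos.smul (inv_pos.2 hε) ht)
  have hε' : ε ≠ 0 := ne_of_gt hε
  have e : ∀ u v : ι → ℝ, v ∈ Pos ι → (ε⁻¹ • u) / (1 + ε⁻¹ • v) = u / (ε • (1 : ι → ℝ) + v) := by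
    intro u v hv; ext i
    simp only [Pi.div_apply, Pi.add_apply, Pi.smul_apply, smul_eq_mul, Pi.one_apply, mul_one]
    have h1 : ε + v i ≠ 0 := (add_pos hε (hv i)).ne'
    have h2 : 1 + ε⁻¹ * v i ≠ 0 := (add_pos one_pos (mul_pos (inv_pos.2 hε) (hv i))).ne'
    rw [div_eq_div_iff h2 h1]
    field_simp
  rw [e _ _ ht, e _ _ hsε] at h
  simp only [Function.comp_apply]
  linarith

/-- In differences over t of the limits in `tendsto_large` the terms F(s/ε) cancel, so the result
does not depend on s; taking s = 1/m and s = 1 gives scale-invariant differences of G(q) - F(1/q).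
-/
lemma exists_logSum_reflect (hF : ContinuousOn F (Pos ι)) (hG : ContinuousOn G (Pos ι))
    (heq : ∀ s ∈ Pos ι, ∀ t ∈ Pos ι, F (s / (1 + t)) - F s = G (t / (1 + s)) - G t) :
    ∃ (n : ι → ℝ) (C : ℝ), ∀ q ∈ Pos ι, G q - F (1 / q) = logSum n q + C := by
  have hlim : ∀ s ∈ Pos ι, ∀ t ∈ Pos ι, Tendsto (fun ε : ℝ => G (ε⁻¹ • t) - F (ε⁻¹ • s)) (𝓝[>] 0)
      (𝓝 (G (t / s) - F (s / t))) := fun s hs t ht =>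
    tendsto_large hF hG heq tendsto_const_nhds hs ht
  apply exists_logSum
  · refine hG.sub (hF.comp ?_ fun q hq => Pos.div Pos.one hq)
    intro q hq
    exact (tendsto_div tendsto_const_nhds tendsto_id hq).mono_left nhdsWithin_le_nhds
  · intro m hm p hp p' hp'
    have hm' := Pos.div Pos.one hm
    have h1 := ((hlim _ hm' p hp).sub (hlim _ hm' p' hp'))
    have h2 := ((hlim 1 Pos.one p hp).sub (hlim 1 Pos.one p' hp'))
    have h3 := tendsto_nhds_unique (h1.congr fun ε => by ring) (h2.congr fun ε => by ring :
      Tendsto (fun ε : ℝ => G (ε⁻¹ • p) - G (ε⁻¹ • p')) _ _)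
    have e1 : ∀ p : ι → ℝ, p / (1 / m) = m * p := by intro p; ext i; simp [_root_.mul_comm]
    have e2 : ∀ p : ι → ℝ, (1 / m) / p = 1 / (m * p) := by
      intro p; ext i; simp [div_eq_mul_inv, _root_.mul_comm]
    rw [e1, e1, e2, e2, div_one, div_one] at h3
    exact h3

lemma eq_logSum_of_reflect (hF : ContinuousOn F (Pos ι)) (hG : ContinuousOn G (Pos ι))
    (heq : ∀ s ∈ Pos ι, ∀ t ∈ Pos ι, F (s / (1 + t)) - F s = G (t / (1 + s)) - G t)
    {n : ι → ℝ} {C : ℝ} (hn : ∀ q ∈ Pos ι, G q - F (1 / q) = logSum n q + C) :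
    ∃ C' : ℝ, ∀ t ∈ Pos ι, G t = logSum n (1 + t) + C' := by
  have hlim : ∀ t ∈ Pos ι, Tendsto (fun ε : ℝ => G (ε • 1)) (𝓝[>] 0)
      (𝓝 (G t - logSum n (1 + t))) := by
    intro t ht
    have ht1 := Pos.one_add ht
    -- Take the first argument of the equation to be (t - ε)/ε: then 1 + s = t/ε and t/(1+s) = ε.
    -- This expresses G(ε1) by G(t) and F(s/(1+t)) - F(s), a difference with a limit by
    -- `tendsto_large`. As the limit of G(ε1) cannot depend on t, G is determined up to a constant.
    have hs : Tendsto (fun ε : ℝ => t - ε • (1 : ι → ℝ)) (𝓝[>] 0) (𝓝 t) := by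
      have : Tendsto (fun ε : ℝ => t - ε • (1 : ι → ℝ)) (𝓝[>] 0)
          (𝓝 (t - (0 : ℝ) • (1 : ι → ℝ))) :=
        (Continuous.tendsto (by fun_prop) 0).mono_left nhdsWithin_le_nhds
      rwa [zero_smul, sub_zero] at this
    have hs' : Tendsto (fun ε : ℝ => (t - ε • (1 : ι → ℝ)) / (1 + t)) (𝓝[>] 0)
        (𝓝 (t / (1 + t))) := tendsto_div hs tendsto_const_nhds ht1
    have h1 := tendsto_large hF hG heq hs ht Pos.one
    have h2 := tendsto_large hF hG heq hs' (Pos.div ht ht1) Pos.one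
    have e0 : ∀ q ∈ Pos ι, G (1 / q) - F (q / 1) = C - logSum n q := by
      intro q hq
      have := hn (1 / q) (Pos.div Pos.one hq)
      have e : 1 / (1 / q) = q := by ext i; simp
      rw [e, logSum_div _ Pos.one hq, logSum_one] at this
      rw [div_one]; linarith
    rw [e0 _ ht] at h1
    rw [e0 _ (Pos.div ht ht1), logSum_div _ ht ht1] at h2
    have h3 := (h1.sub h2).add_const (G t)
    have e1 : C - logSum n t - (C - (logSum n t - logSum n (1 + t))) + G t
        = G t - logSum n (1 + t) := by ring
    rw [e1] at h3
    refine h3.congr' ?_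
    filter_upwards [self_mem_nhdsWithin, hs.eventually (isOpen_Pos.mem_nhds ht)] with ε hε hsε
    have hε' : ε ≠ 0 := ne_of_gt hε
    have h := heq (ε⁻¹ • (t - ε • (1 : ι → ℝ))) (Pos.smul (inv_pos.2 hε) hsε) t ht
    have e2 : t / (1 + ε⁻¹ • (t - ε • (1 : ι → ℝ))) = ε • 1 := by
      rw [smul_sub, inv_smul_smul₀ hε', add_sub_cancel]
      ext i
      have := (ht i).ne'
      simp only [Pi.div_apply, Pi.smul_apply, smul_eq_mul, Pi.one_apply]
      field_simp
    have e3 : ε⁻¹ • ((t - ε • (1 : ι → ℝ)) / (1 + t)) = ε⁻¹ • (t - ε • (1 : ι → ℝ)) / (1 + t) := by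
      ext i; simp only [Pi.div_apply, Pi.smul_apply, smul_eq_mul]; ring
    rw [e2] at h
    rw [e3]
    linarith
  refine ⟨G 1 - logSum n (1 + 1), fun t ht => ?_⟩
  have := tendsto_nhds_unique (hlim t ht) (hlim 1 Pos.one)
  linarith

lemma exists_logSum_of_reduced (hF : ContinuousOn F (Pos ι)) (hG : ContinuousOn G (Pos ι))
    (heq : ∀ s ∈ Pos ι, ∀ t ∈ Pos ι, F (s / (1 + t)) - F s = G (t / (1 + s)) - G t) :
    ∃ (n : ι → ℝ) (C C' : ℝ), (∀ s ∈ Pos ι, F s = logSum n (1 + s) + C) ∧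
      (∀ t ∈ Pos ι, G t = logSum n (1 + t) + C') := by
  obtain ⟨n, c, hn⟩ := exists_logSum_reflect hF hG heq
  obtain ⟨C', hC'⟩ := eq_logSum_of_reflect hF hG heq hn
  have hn' : ∀ q ∈ Pos ι, F q - G (1 / q) = logSum n q + (-c) := by
    intro q hq
    have := hn (1 / q) (Pos.div Pos.one hq)
    have e : 1 / (1 / q) = q := by ext i; simp
    rw [e, logSum_div _ Pos.one hq, logSum_one] at this
    linarith
  obtain ⟨C, hC⟩ := eq_logSum_of_reflect hG hF (fun s hs t ht => (heq t ht s hs).symm) hn'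
  exact ⟨n, C, C', hC, hC'⟩

end Reduced

/-- The general continuous solution. -/
theorem exists_solution {F G H K : (ι → ℝ) → ℝ} (hF : ContinuousOn F (Pos ι))
    (hG : ContinuousOn G (Pos ι)) (hH : ContinuousOn H (Pos ι)) (hK : ContinuousOn K (Pos ι))
    (heq : ∀ s ∈ Pos ι, ∀ t ∈ Pos ι, F (s / (1 + t)) + G t = H (t / (1 + s)) + K s) :
    ∃ (a b d : ι → ℝ) (C₁ C₂ C₃ C₄ : ℝ), (∀ u ∈ Pos ι,
      F u = -logSum a (1 + u) + (logSum b u - logSum b (1 + u)) - logSum d (1 + u) + C₁ ∧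
      G u = -logSum a (1 + u) + (logSum d u - logSum d (1 + u)) + C₂ ∧
      H u = -logSum a (1 + u) - logSum b (1 + u) + (logSum d u - logSum d (1 + u)) + C₃ ∧
      K u = -logSum a (1 + u) + (logSum b u - logSum b (1 + u)) + C₄) ∧
      C₁ + C₂ = C₃ + C₄ := by
  obtain ⟨b, c₁, hb⟩ := exists_logSum_sub hG hH heq
  obtain ⟨d, c₂, hd⟩ := exists_logSum_sub hK hF fun s hs t ht => (heq t ht s hs).symm
  -- subtract the special solutions given by `b` and `d`
  let F' : (ι → ℝ) → ℝ := fun u => F u + (logSum b u - logSum b (1 + u)) - logSum d (1 + u)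
  let G' : (ι → ℝ) → ℝ := fun u => G u + (logSum d u - logSum d (1 + u))
  have hl : ∀ δ : ι → ℝ, ContinuousOn (fun u => logSum δ (1 + u)) (Pos ι) := fun δ =>
    (continuousOn_logSum δ).comp (by fun_prop) fun u hu => Pos.one_add hu
  have hF' : ContinuousOn F' (Pos ι) := (hF.add ((continuousOn_logSum b).sub (hl b))).sub (hl d)
  have hG' : ContinuousOn G' (Pos ι) := hG.add ((continuousOn_logSum d).sub (hl d))
  have key : ∀ s ∈ Pos ι, ∀ t ∈ Pos ι,
      F' (s / (1 + t)) - F' s = G' (t / (1 + s)) - G' t + (c₁ - c₂) := by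
    intro s hs t ht
    have h := heq s hs t ht
    have hs1 := Pos.one_add hs
    have ht1 := Pos.one_add ht
    rw [hb _ (Pos.div ht hs1)] at h
    have h2 := hd s hs
    have hst : 1 + s + t ∈ Pos ι := fun i => add_pos (hs1 i) (ht i)
    have e1 : 1 + t / (1 + s) = (1 + s + t) / (1 + s) := by
      ext i; have := (hs1 i).ne'
      simp only [Pi.add_apply, Pi.div_apply, Pi.one_apply] at *; field_simp
    have e2 : 1 + s / (1 + t) = (1 + s + t) / (1 + t) := by
      ext i; have := (ht1 i).ne'
      simp only [Pi.add_apply, Pi.div_apply, Pi.one_apply] at *; field_simp; ring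
    simp only [F', G']
    rw [e1, logSum_div _ hst hs1] at h
    rw [e1, e2, logSum_div _ hst hs1, logSum_div _ hst ht1, logSum_div _ hst ht1,
      logSum_div _ hs ht1, logSum_div _ ht hs1]
    linarith
  have hc : c₁ - c₂ = 0 := eq_zero_of_reduced hG' key
  rw [hc] at key
  simp only [add_zero] at key
  obtain ⟨n, C, C', hn, hn'⟩ := exists_logSum_of_reduced hF' hG' key
  -- For x = u/(1+u) one has log(1-x) = -log(1+u) and log x = log u - log(1+u), the building blocks
  -- of the target; hence the sign changes.
  refine ⟨-n, -b, -d, C, C', C' + c₁, C - c₂, fun u hu => ?_, by linarith⟩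
  have h1 := hn u hu
  have h2 := hn' u hu
  have h3 := hb u hu
  have h4 := hd u hu
  simp only [F', G'] at h1 h2
  simp only [neg_logSum]
  refine ⟨?_, ?_, ?_, ?_⟩ <;> linarith

end

end InformationEquation

namespace EuclideanJordanAlgebra

open Filter Topology

open InformationEquation

variable {E : Type*} [NormedAddCommGroup E] [InnerProductSpace ℝ E]

/-! ### The division algorithm -/

lemma IsSystem.g₁_sum_sum {J : EuclideanJordanAlgebra E} {ι : Type*} [Fintype ι] {c : ι → E}
    (hc : J.IsSystem c) {l : ι → ℝ} (hl : ∀ i, 0 < l i) (a : ι → ℝ) :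
    J.g₁ (∑ i, l i • c i) (∑ i, a i • c i) = ∑ i, (a i / l i) • c i := by
  rw [hc.g₁_sum hl, P_self, hc.mul_sum, hc.mul_sum, hc.mul_sum, hc.mul_sum, Finset.smul_sum,
    ← Finset.sum_sub_distrib]
  refine Finset.sum_congr rfl fun i _ => ?_
  rw [smul_smul, ← sub_smul]
  congr 1
  have h : (√(l i))⁻¹ * (√(l i))⁻¹ = (l i)⁻¹ := by
    rw [← mul_inv, Real.mul_self_sqrt (hl i).le]
  linear_combination (a i) * h

lemma g₁_self {J : EuclideanJordanAlgebra E} {u : E} (hu : u ∈ J.cone) : J.g₁ u u = J.e := by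
  obtain ⟨r, c, l, hc, rfl⟩ := J.exists_frame u
  have hl := hc.mem_cone_iff.1 hu
  rw [hc.isSystem.g₁_sum_sum hl, ← hc.isSystem.sum_eq]
  exact Finset.sum_congr rfl fun i _ => by rw [div_self (hl i).ne', one_smul]

lemma g₁_mem_cone {J : EuclideanJordanAlgebra E} {u z : E} (hu : u ∈ J.cone) (hz : z ∈ J.cone) :
    J.g₁ u z ∈ J.cone := by
  obtain ⟨r, c, l, hc, rfl⟩ := J.exists_frame u
  have hl := hc.mem_cone_iff.1 hu
  rw [hc.isSystem.g₁_sum hl]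
  exact P_mem_cone (hc.isSystem.mem_cone fun i => inv_pos.2 (Real.sqrt_pos.2 (hl i))) hz

lemma g₁_smul {J : EuclideanJordanAlgebra E} {u : E} (hu : u ∈ J.cone) {t : ℝ} (ht : 0 < t)
    (z : E) : J.g₁ (t • u) z = t⁻¹ • J.g₁ u z := by
  obtain ⟨r, c, l, hc, rfl⟩ := J.exists_frame u
  have hl := hc.mem_cone_iff.1 hu
  have e : t • ∑ i, l i • c i = ∑ i, (t * l i) • c i := by
    simp only [Finset.smul_sum, smul_smul]
  rw [e, hc.isSystem.g₁_sum hl, hc.isSystem.g₁_sum fun i => mul_pos ht (hl i)]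
  have e2 : ∑ i, (√(t * l i))⁻¹ • c i = (√t)⁻¹ • ∑ i, (√(l i))⁻¹ • c i := by
    rw [Finset.smul_sum]
    refine Finset.sum_congr rfl fun i _ => ?_
    rw [Real.sqrt_mul ht.le, mul_inv, smul_smul]
  rw [e2, P_smul, LinearMap.smul_apply, inv_pow, Real.sq_sqrt ht.le]

lemma tendsto_e_sub (J : EuclideanJordanAlgebra E) (y : E) :
    Tendsto (fun ε : ℝ => J.e - ε • y) (𝓝[>] 0) (𝓝 J.e) := by
  have : Tendsto (fun ε : ℝ => J.e - ε • y) (𝓝[>] 0) (𝓝 (J.e - (0 : ℝ) • y)) :=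
    (Continuous.tendsto (by fun_prop) 0).mono_left nhdsWithin_le_nhds
  rwa [zero_smul, sub_zero] at this

lemma eventually_e_sub_mem_cone (J : EuclideanJordanAlgebra E) (y : E) :
    ∀ᶠ ε : ℝ in 𝓝[>] 0, J.e - ε • y ∈ J.cone :=
  (J.tendsto_e_sub y).eventually (J.isOpen_cone.mem_nhds J.e_mem_cone)

/-- Along e - εy all square roots are diagonal in a frame of y, so the limit is coordinatewise and
continuity of the square root on the cone is not needed. -/
lemma tendsto_g₁ (J : EuclideanJordanAlgebra E) (y z : E) :
    Tendsto (fun ε : ℝ => J.g₁ (J.e - ε • y) z) (𝓝[>] 0) (𝓝 z) := by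
  obtain ⟨r, c, l, hc, rfl⟩ := J.exists_frame y
  have hs := hc.isSystem
  have e : ∀ ε : ℝ, J.e - ε • ∑ i, l i • c i = ∑ i, (1 - ε * l i) • c i := fun ε => by
    rw [← hs.e_sub]
    simp only [Finset.smul_sum, smul_smul]
  have h1 : Tendsto (fun ε : ℝ => ∑ i, (√(1 - ε * l i))⁻¹ • c i) (𝓝[>] 0) (𝓝 J.e) := by
    rw [← hs.sum_eq]
    refine tendsto_finsetSum _ fun i _ => ?_
    have h2 : Tendsto (fun ε : ℝ => √(1 - ε * l i)) (𝓝[>] 0) (𝓝 √(1 - 0 * l i)) :=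
      (Continuous.tendsto (by fun_prop) 0).mono_left nhdsWithin_le_nhds
    simp only [zero_mul, sub_zero, Real.sqrt_one] at h2
    simpa using (h2.inv₀ one_ne_zero).smul_const (c i)
  have h2 : Continuous fun x => J.P x z := by fun_prop
  have h3 := (h2.tendsto J.e).comp h1
  rw [P_e, Module.End.one_apply] at h3
  refine h3.congr' ?_
  filter_upwards [J.eventually_e_sub_mem_cone (∑ i, l i • c i)] with ε hε
  rw [e] at hε ⊢
  rw [hs.g₁_sum (hc.mem_cone_iff.1 hε)]
  rfl

/-! ### Spectral logarithms -/

/-- A continuous function on the cone which, along each frame, is a linear combination of the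
logarithms of the eigenvalues. -/
structure IsSpectralLog (J : EuclideanJordanAlgebra E) (A : E → ℝ) : Prop where
  continuousOn : ContinuousOn A J.cone
  frame : ∀ (r : ℕ) (c : Fin r → E), J.IsFrame c →
    ∃ κ : Fin r → ℝ, ∀ l ∈ Pos (Fin r), A (∑ i, l i • c i) = logSum κ l

lemma logSum_const {ι : Type*} [Fintype ι] (κ : ι → ℝ) (t : ℝ) :
    logSum κ (fun _ => t) = (∑ i, κ i) * Real.log t := by
  simp only [logSum, Finset.sum_mul]

lemma IsSpectralLog.smul {J : EuclideanJordanAlgebra E} {A : E → ℝ} (hA : J.IsSpectralLog A)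
    {x : E} (hx : x ∈ J.cone) {t : ℝ} (ht : 0 < t) : A (t • x) = A x + A (t • J.e) := by
  obtain ⟨r, c, l, hc, rfl⟩ := J.exists_frame x
  have hl := hc.mem_cone_iff.1 hx
  obtain ⟨κ, hκ⟩ := hA.frame r c hc
  have e : t • ∑ i, l i • c i = ∑ i, (l * fun _ => t : Fin r → ℝ) i • c i := by
    simp only [Finset.smul_sum, smul_smul, Pi.mul_apply, _root_.mul_comm]
  rw [e, hκ _ (Pos.mul hl fun _ => ht), hc.isSystem.smul_e, hκ l hl, hκ _ fun _ => ht,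
    logSum_mul _ hl fun _ => ht]

lemma IsSpectralLog.e {J : EuclideanJordanAlgebra E} {A : E → ℝ} (hA : J.IsSpectralLog A) :
    A J.e = 0 := by
  have := hA.smul J.e_mem_cone one_pos
  rw [one_smul] at this
  linarith

lemma IsSpectralLog.mul_self {J : EuclideanJordanAlgebra E} {A : E → ℝ} (hA : J.IsSpectralLog A)
    {x : E} (hx : x ∈ J.cone) : A (J.mul x x) = 2 * A x := by
  obtain ⟨r, c, l, hc, rfl⟩ := J.exists_frame x
  have hl := hc.mem_cone_iff.1 hx
  obtain ⟨κ, hκ⟩ := hA.frame r c hc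
  rw [hc.isSystem.mul_sum]
  have := hκ _ (Pos.mul hl hl)
  simp only [Pi.mul_apply] at this
  rw [this, hκ l hl, logSum_mul _ hl hl]; ring

lemma IsSpectralLog.continuousAt {J : EuclideanJordanAlgebra E} {A : E → ℝ}
    (hA : J.IsSpectralLog A) {x : E} (hx : x ∈ J.cone) : ContinuousAt A x :=
  hA.continuousOn.continuousAt (J.isOpen_cone.mem_nhds hx)

/-- A function on `D` which is spectrally logarithmic there extends to the cone. -/
lemma exists_isSpectralLog_extension (J : EuclideanJordanAlgebra E) {a : E → ℝ}
    (ha : ContinuousOn a J.D) (S : ℝ)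
    (h : ∀ (r : ℕ) (c : Fin r → E), J.IsFrame c → ∃ κ : Fin r → ℝ, ∑ i, κ i = S ∧
      ∀ l : Fin r → ℝ, (∀ i, 0 < l i ∧ l i < 1) → a (∑ i, l i • c i) = logSum κ l) :
    ∃ A : E → ℝ, J.IsSpectralLog A ∧ ∀ x ∈ J.D, a x = A x := by
  -- m x exceeds ‖L‖‖x‖, so x / m x lies in D. Since the coefficients sum to S on every frame,
  -- scaling back adds S log (m x) whatever the frame.
  let m : E → ℝ := fun x => 1 + ‖J.mulL‖ * ‖x‖
  have hm : ∀ x, 0 < m x := fun x => by positivity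
  have hmc : Continuous m := by fun_prop
  have hmD : ∀ x ∈ J.cone, (m x)⁻¹ • x ∈ J.D := by
    intro x hx
    refine ⟨smul_mem_cone (inv_pos.2 (hm x)) hx, ?_⟩
    have h1 : m x • J.e - x ∈ J.cone := J.smul_e_sub_mem_cone (by simp only [m]; linarith)
    have h2 := smul_mem_cone (inv_pos.2 (hm x)) h1
    rwa [smul_sub, inv_smul_smul₀ (hm x).ne'] at h2
  let A : E → ℝ := fun x => a ((m x)⁻¹ • x) + S * Real.log (m x)
  have hframe : ∀ (r : ℕ) (c : Fin r → E) (hc : J.IsFrame c) (κ : Fin r → ℝ), ∑ i, κ i = S →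
      (∀ l : Fin r → ℝ, (∀ i, 0 < l i ∧ l i < 1) → a (∑ i, l i • c i) = logSum κ l) →
      ∀ l ∈ Pos (Fin r), A (∑ i, l i • c i) = logSum κ l := by
    intro r c hc κ hS hκ l hl
    set x := ∑ i, l i • c i
    have hx : x ∈ J.cone := hc.mem_cone_iff.2 hl
    have e : (m x)⁻¹ • x = ∑ i, ((fun _ => (m x)⁻¹) * l : Fin r → ℝ) i • c i := by
      simp only [x, Finset.smul_sum, smul_smul, Pi.mul_apply]
    have hD := hmD x hx
    rw [e, hc.mem_D_iff] at hD
    simp only [A]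
    rw [e, hκ _ hD, logSum_mul _ (fun _ => inv_pos.2 (hm x)) hl, logSum_const, hS, Real.log_inv]
    ring
  refine ⟨A, ⟨?_, ?_⟩, ?_⟩
  · refine ContinuousOn.add (ha.comp ?_ hmD) ?_
    · exact ((hmc.inv₀ fun x => (hm x).ne').smul continuous_id).continuousOn
    · exact (continuous_const.mul (hmc.log fun x => (hm x).ne')).continuousOn
  · intro r c hc
    obtain ⟨κ, hS, hκ⟩ := h r c hc
    exact ⟨κ, hframe r c hc κ hS hκ⟩
  · intro x hx
    obtain ⟨r, c, l, hc, rfl⟩ := J.exists_frame x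
    obtain ⟨κ, hS, hκ⟩ := h r c hc
    have hl := hc.mem_D_iff.1 hx
    rw [hframe r c hc κ hS hκ l fun i => (hl i).1, hκ l hl]

/-! ### Solving the equation along a frame -/

/-- The substitution x = s/(1+s+t), y = t/(1+s+t) gives x/(1-x) = s/(1+t) and y/(1-x) = t/(1+t),
with the same formulas after exchanging the roles; in the coordinate u = x/(1-x) this is the orthant
equation. -/
lemma IsFrame.exists_solution {J : EuclideanJordanAlgebra E} {f g h k : E → ℝ}
    (hf : ContinuousOn f J.D) (hg : ContinuousOn g J.D)
    (hh : ContinuousOn h J.D) (hk : ContinuousOn k J.D)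
    (heq : ∀ x y : E, (x, y) ∈ J.D₀ →
      f x + g (J.g₁ (J.e - x) y) = h y + k (J.g₁ (J.e - y) x))
    {r : ℕ} {c : Fin r → E} (hc : J.IsFrame c) :
    ∃ (a b d : Fin r → ℝ) (C₁ C₂ C₃ C₄ : ℝ), C₁ + C₂ = C₃ + C₄ ∧
      ∀ l : Fin r → ℝ, (∀ i, 0 < l i ∧ l i < 1) →
        f (∑ i, l i • c i) = logSum a (1 - l) + logSum b l + logSum d (1 - l) + C₁ ∧
        g (∑ i, l i • c i) = logSum a (1 - l) + logSum d l + C₂ ∧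
        h (∑ i, l i • c i) = logSum a (1 - l) + logSum b (1 - l) + logSum d l + C₃ ∧
        k (∑ i, l i • c i) = logSum a (1 - l) + logSum b l + C₄ := by
  have hs := hc.isSystem
  let X : (Fin r → ℝ) → E := fun u => ∑ i, (u / (1 + u)) i • c i
  have hfrac : ∀ {u v : Fin r → ℝ}, u ∈ Pos (Fin r) → v ∈ Pos (Fin r) →
      ∀ i, 0 < (u / (v + u)) i ∧ (u / (v + u)) i < 1 := by
    intro u v hu hv i
    have h1 := hu i
    have h2 := hv i
    simp only [Pi.div_apply, Pi.add_apply]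
    refine ⟨by positivity, (div_lt_one (by positivity)).2 (by linarith)⟩
  have hX : ∀ u ∈ Pos (Fin r), X u ∈ J.D := fun u hu => hc.mem_D_iff.2 (hfrac hu Pos.one)
  have hXc : ContinuousOn X (Pos (Fin r)) := by
    refine continuousOn_finsetSum _ fun i _ => ContinuousOn.smul ?_ continuousOn_const
    simp only [Pi.div_apply, Pi.add_apply, Pi.one_apply]
    refine ContinuousOn.div (by fun_prop) (by fun_prop) fun u hu => ?_
    have := hu i
    positivity
  obtain ⟨a, b, d, C₁, C₂, C₃, C₄, hsol, hC⟩ := InformationEquation.exists_solution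
    (hf.comp hXc hX) (hg.comp hXc hX) (hh.comp hXc hX) (hk.comp hXc hX) (by
      intro s hs' t ht
      have hden : ∀ i, 0 < 1 + s i + t i := fun i => by
        have := hs' i; have := ht i; positivity
      have h1s : ∀ i, 0 < 1 + s i := Pos.one_add hs'
      have h1t : ∀ i, 0 < 1 + t i := Pos.one_add ht
      let x : Fin r → ℝ := fun i => s i / (1 + s i + t i)
      let y : Fin r → ℝ := fun i => t i / (1 + s i + t i)
      have hx1 : ∀ i, 1 - x i = (1 + t i) / (1 + s i + t i) := fun i => by
        have := (hden i).ne'; simp only [x]; field_simp; ring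
      have hy1 : ∀ i, 1 - y i = (1 + s i) / (1 + s i + t i) := fun i => by
        have := (hden i).ne'; simp only [y]; field_simp; ring
      have hx0 : ∀ i, 0 < x i := fun i => div_pos (hs' i) (hden i)
      have hy0 : ∀ i, 0 < y i := fun i => div_pos (ht i) (hden i)
      have hx1' : ∀ i, 0 < 1 - x i := fun i => by rw [hx1]; exact div_pos (h1t i) (hden i)
      have hy1' : ∀ i, 0 < 1 - y i := fun i => by rw [hy1]; exact div_pos (h1s i) (hden i)
      have hxy : ∀ i, x i + y i < 1 := fun i => by
        simp only [x, y]; rw [← add_div, div_lt_one (hden i)]; linarith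
      have h0 := heq (∑ i, x i • c i) (∑ i, y i • c i) ⟨
        hc.mem_D_iff.2 fun i => ⟨hx0 i, by linarith [hx1' i]⟩,
        hc.mem_D_iff.2 fun i => ⟨hy0 i, by linarith [hy1' i]⟩, by
          simp only [← Finset.sum_add_distrib, ← add_smul]
          exact hc.mem_D_iff.2 fun i => ⟨add_pos (hx0 i) (hy0 i), hxy i⟩⟩
      rw [hs.e_sub, hs.e_sub, hs.g₁_sum_sum hx1', hs.g₁_sum_sum hy1'] at h0
      have e1 : X (s / (1 + t)) = ∑ i, x i • c i := Finset.sum_congr rfl fun i _ => by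
        congr 1
        have := (h1t i).ne'; have := (hden i).ne'
        have : 1 + s i / (1 + t i) = (1 + s i + t i) / (1 + t i) := by field_simp; ring
        simp only [x, Pi.div_apply, Pi.add_apply, Pi.one_apply, this]
        field_simp
      have e2 : X (t / (1 + s)) = ∑ i, y i • c i := Finset.sum_congr rfl fun i _ => by
        congr 1
        have := (h1s i).ne'; have := (hden i).ne'
        have : 1 + t i / (1 + s i) = (1 + s i + t i) / (1 + s i) := by field_simp
        simp only [y, Pi.div_apply, Pi.add_apply, Pi.one_apply, this]
        field_simp
      have e3 : X t = ∑ i, (y i / (1 - x i)) • c i := Finset.sum_congr rfl fun i _ => by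
        congr 1
        have := (h1t i).ne'; have := (hden i).ne'
        rw [hx1]
        simp only [y, Pi.div_apply, Pi.add_apply, Pi.one_apply]
        field_simp
      have e4 : X s = ∑ i, (x i / (1 - y i)) • c i := Finset.sum_congr rfl fun i _ => by
        congr 1
        have := (h1s i).ne'; have := (hden i).ne'
        rw [hy1]
        simp only [x, Pi.div_apply, Pi.add_apply, Pi.one_apply]
        field_simp
      simp only [Function.comp_apply]
      rw [e1, e2, e3, e4]
      exact h0)
  refine ⟨a, b, d, C₁, C₂, C₃, C₄, hC, fun l hl => ?_⟩
  have hl0 : l ∈ Pos (Fin r) := fun i => (hl i).1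
  have hl1 : 1 - l ∈ Pos (Fin r) := fun i => sub_pos.2 (hl i).2
  have hu : l / (1 - l) ∈ Pos (Fin r) := Pos.div hl0 hl1
  have e1 : 1 + l / (1 - l) = 1 / (1 - l) := by
    ext i
    have h1 : 1 - l i ≠ 0 := (hl1 i).ne'
    simp only [Pi.add_apply, Pi.div_apply, Pi.sub_apply, Pi.one_apply]
    field_simp; ring
  have e2 : X (l / (1 - l)) = ∑ i, l i • c i := Finset.sum_congr rfl fun i _ => by
    congr 1
    rw [e1]
    have h1 : 1 - l i ≠ 0 := (hl1 i).ne'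
    simp only [Pi.div_apply, Pi.sub_apply, Pi.one_apply]
    field_simp
  have h0 := hsol _ hu
  simp only [Function.comp_apply, e2, e1, logSum_div _ hl0 hl1, logSum_div _ Pos.one hl1,
    logSum_one] at h0
  obtain ⟨h1, h2, h3, h4⟩ := h0
  refine ⟨?_, ?_, ?_, ?_⟩ <;> linarith

lemma log_affine_unique {α γ α' γ' : ℝ}
    (h : ∀ t : ℝ, 0 < t → t < 1 → α * Real.log (1 - t) + γ = α' * Real.log (1 - t) + γ') :
    α = α' ∧ γ = γ' := by
  have h1 := h (1 / 2) (by norm_num) (by norm_num)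
  have h2 := h (3 / 4) (by norm_num) (by norm_num)
  have e : Real.log (1 - 3 / 4) = 2 * Real.log (1 - 1 / 2) := by
    rw [two_mul, ← Real.log_mul (by norm_num) (by norm_num)]; norm_num
  have hL : Real.log (1 - 1 / 2) ≠ 0 := (Real.log_neg (by norm_num) (by norm_num)).ne
  rw [e] at h2
  set L := Real.log (1 - 1 / 2)
  have h3 : (α - α') * L = 0 := by linear_combination h2 - h1
  have h4 : α = α' := by
    rcases mul_eq_zero.1 h3 with h | h
    · linarith
    · exact absurd h hL
  exact ⟨h4, by rw [h4] at h1; linarith⟩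

/-- The four functions are combinations of three spectral logarithms. -/
theorem exists_spectralLogs {J : EuclideanJordanAlgebra E} {f g h k : E → ℝ}
    (hf : ContinuousOn f J.D) (hg : ContinuousOn g J.D)
    (hh : ContinuousOn h J.D) (hk : ContinuousOn k J.D)
    (heq : ∀ x y : E, (x, y) ∈ J.D₀ →
      f x + g (J.g₁ (J.e - x) y) = h y + k (J.g₁ (J.e - y) x)) :
    ∃ (A B G : E → ℝ) (C₁ C₂ C₃ C₄ : ℝ), J.IsSpectralLog A ∧ J.IsSpectralLog B ∧
      J.IsSpectralLog G ∧ C₁ + C₂ = C₃ + C₄ ∧ ∀ x ∈ J.D,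
        f x = A (J.e - x) + B x + G (J.e - x) + C₁ ∧
        g x = A (J.e - x) + G x + C₂ ∧
        h x = A (J.e - x) + B (J.e - x) + G x + C₃ ∧
        k x = A (J.e - x) + B x + C₄ := by
  have hframe := fun (r : ℕ) (c : Fin r → E) (hc : J.IsFrame c) =>
    hc.exists_solution hf hg hh hk heq
  obtain ⟨r₀, c₀, -, hc₀, -⟩ := J.exists_frame J.e
  obtain ⟨a₀, b₀, d₀, C₁, C₂, C₃, C₄, hC, h₀⟩ := hframe r₀ c₀ hc₀
  have hone : ∀ (r : ℕ) (t : ℝ), (1 - fun _ => t : Fin r → ℝ) = fun _ => 1 - t := fun _ _ => rfl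
  -- the constants do not depend on the frame
  have hconst : ∀ (r : ℕ) (c : Fin r → E), J.IsFrame c → ∃ a b d : Fin r → ℝ,
      ∑ i, a i = ∑ i, a₀ i ∧ ∑ i, b i = ∑ i, b₀ i ∧ ∑ i, d i = ∑ i, d₀ i ∧
      ∀ l : Fin r → ℝ, (∀ i, 0 < l i ∧ l i < 1) →
        f (∑ i, l i • c i) = logSum a (1 - l) + logSum b l + logSum d (1 - l) + C₁ ∧
        g (∑ i, l i • c i) = logSum a (1 - l) + logSum d l + C₂ ∧
        h (∑ i, l i • c i) = logSum a (1 - l) + logSum b (1 - l) + logSum d l + C₃ ∧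
        k (∑ i, l i • c i) = logSum a (1 - l) + logSum b l + C₄ := by
    intro r c hc
    obtain ⟨a, b, d, C₁', C₂', C₃', C₄', hC', h'⟩ := hframe r c hc
    -- Both frames represent the same element te, so the two formulas can be compared there; h - g
    -- isolates the sum of b, and f - k the sum of d.
    have ht : ∀ t : ℝ, 0 < t → t < 1 → _ := fun t ht0 ht1 => h' (fun _ => t) fun _ => ⟨ht0, ht1⟩
    have ht₀ : ∀ t : ℝ, 0 < t → t < 1 → _ := fun t ht0 ht1 => h₀ (fun _ => t) fun _ => ⟨ht0, ht1⟩
    simp only [← hc.isSystem.smul_e, hone, logSum_const] at ht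
    simp only [← hc₀.isSystem.smul_e, hone, logSum_const] at ht₀
    obtain ⟨hb, hb'⟩ := log_affine_unique (α := ∑ i, b i) (γ := C₃' - C₂') (α' := ∑ i, b₀ i)
      (γ' := C₃ - C₂) fun t h0 h1 => by
        obtain ⟨-, p2, p3, -⟩ := ht t h0 h1
        obtain ⟨-, q2, q3, -⟩ := ht₀ t h0 h1
        linarith
    obtain ⟨hd, hd'⟩ := log_affine_unique (α := ∑ i, d i) (γ := C₁' - C₄') (α' := ∑ i, d₀ i)
      (γ' := C₁ - C₄) fun t h0 h1 => by
        obtain ⟨p1, -, -, p4⟩ := ht t h0 h1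
        obtain ⟨q1, -, -, q4⟩ := ht₀ t h0 h1
        linarith
    obtain ⟨ha, ha'⟩ := log_affine_unique (α := ∑ i, a i) (γ := C₂') (α' := ∑ i, a₀ i)
      (γ' := C₂) fun t h0 h1 => by
        obtain ⟨-, p2, -, -⟩ := ht t h0 h1
        obtain ⟨-, q2, -, -⟩ := ht₀ t h0 h1
        rw [hd] at p2
        linarith
    obtain ⟨-, ha''⟩ := log_affine_unique (α := ∑ i, a i) (γ := C₄') (α' := ∑ i, a₀ i)
      (γ' := C₄) fun t h0 h1 => by
        obtain ⟨-, -, -, p4⟩ := ht t h0 h1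
        obtain ⟨-, -, -, q4⟩ := ht₀ t h0 h1
        rw [hb] at p4
        linarith
    obtain rfl : C₂' = C₂ := ha'
    obtain rfl : C₄' = C₄ := ha''
    obtain rfl : C₃' = C₃ := by linarith
    obtain rfl : C₁' = C₁ := by linarith
    exact ⟨a, b, d, ha, hb, hd, h'⟩
  have hflip : ContinuousOn (fun x => J.e - x) J.D := by fun_prop
  have hmaps : Set.MapsTo (fun x => J.e - x) J.D J.D := fun x hx =>
    ⟨hx.2, by rw [sub_sub_cancel]; exact hx.1⟩
  have hflip' : ∀ {r : ℕ} {l : Fin r → ℝ}, (∀ i, 0 < l i ∧ l i < 1) →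
      ∀ i, 0 < (1 - l) i ∧ (1 - l) i < 1 := fun hl i =>
    ⟨sub_pos.2 (hl i).2, sub_lt_self _ (hl i).1⟩
  have hes : ∀ {r : ℕ} {c : Fin r → E} (hc : J.IsFrame c) (l : Fin r → ℝ),
      J.e - ∑ i, l i • c i = ∑ i, (1 - l) i • c i := fun hc l => hc.isSystem.e_sub l
  have hk' := hk.comp hflip hmaps
  have hf' := hf.comp hflip hmaps
  have hg' := hg.comp hflip hmaps
  have hh' := hh.comp hflip hmaps
  -- B and G are read off from h - g and f - k at e - u, and A from g once G is known; defining them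
  -- through the given functions makes them frame-independent and continuous.
  obtain ⟨B, hB, hBe⟩ := J.exists_isSpectralLog_extension
    (a := fun u => h (J.e - u) - g (J.e - u) - (C₃ - C₂))
    ((hh'.sub hg').sub continuousOn_const) (∑ i, b₀ i) (by
      intro r c hc
      obtain ⟨a, b, d, ha, hb, hd, hl⟩ := hconst r c hc
      refine ⟨b, hb, fun l hl' => ?_⟩
      obtain ⟨-, p2, p3, -⟩ := hl _ (hflip' hl')
      simp only [hes hc]
      rw [p2, p3, sub_sub_cancel]; ring)
  obtain ⟨G, hG, hGe⟩ := J.exists_isSpectralLog_extension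
    (a := fun u => f (J.e - u) - k (J.e - u) - (C₁ - C₄))
    ((hf'.sub hk').sub continuousOn_const) (∑ i, d₀ i) (by
      intro r c hc
      obtain ⟨a, b, d, ha, hb, hd, hl⟩ := hconst r c hc
      refine ⟨d, hd, fun l hl' => ?_⟩
      obtain ⟨p1, -, -, p4⟩ := hl _ (hflip' hl')
      simp only [hes hc]
      rw [p1, p4, sub_sub_cancel]; ring)
  obtain ⟨A, hA, hAe⟩ := J.exists_isSpectralLog_extension
    (a := fun u => g (J.e - u) - (f u - k u - (C₁ - C₄)) - C₂)
    ((hg'.sub ((hf.sub hk).sub continuousOn_const)).sub continuousOn_const) (∑ i, a₀ i) (by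
      intro r c hc
      obtain ⟨a, b, d, ha, hb, hd, hl⟩ := hconst r c hc
      refine ⟨a, ha, fun l hl' => ?_⟩
      obtain ⟨-, p2, -, -⟩ := hl _ (hflip' hl')
      obtain ⟨p1, -, -, p4⟩ := hl _ hl'
      simp only [hes hc]
      rw [p1, p2, p4, sub_sub_cancel]; ring)
  refine ⟨A, B, G, C₁, C₂, C₃, C₄, hA, hB, hG, hC, fun x hx => ?_⟩
  have hx' : J.e - x ∈ J.D := hmaps hx
  have b1 := hBe _ hx
  have b2 := hBe _ hx'
  have g1 := hGe _ hx
  have g2 := hGe _ hx'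
  have a2 := hAe _ hx'
  simp only [sub_sub_cancel] at b1 b2 g1 g2 a2
  obtain ⟨r, c, l, hc, hxl⟩ := J.exists_frame x
  obtain ⟨a, b, d, ha, hb, hd, hl⟩ := hconst r c hc
  have hl01 := hc.mem_D_iff.1 (hxl ▸ hx)
  obtain ⟨p1, p2, p3, p4⟩ := hl l hl01
  obtain ⟨q1, q2, q3, q4⟩ := hl _ (hflip' hl01)
  rw [← hes hc] at q1 q2 q3 q4
  rw [← hxl] at p1 p2 p3 p4 q1 q2 q3 q4
  rw [sub_sub_cancel] at q1 q2 q3 q4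
  refine ⟨?_, ?_, ?_, ?_⟩ <;> linarith

/-! ### From spectral logarithms to logarithmic functions on the cone. -/

/-- Logarithmic functions with respect to the multiplication algorithm `w₁`. -/
def IsLogarithmic (J : EuclideanJordanAlgebra E) (A : E → ℝ) : Prop :=
  ∀ u ∈ J.cone, ∀ z ∈ J.cone, A u + A (J.g₁ u z) = A z

/-- The logarithmic identity is invariant under scaling u, so u may be brought into whatever region
the equation reaches. -/
lemma IsSpectralLog.logarithmic_smul {J : EuclideanJordanAlgebra E} {A : E → ℝ}
    (hA : J.IsSpectralLog A) {u z : E} (hu : u ∈ J.cone) (hz : z ∈ J.cone) {t : ℝ} (ht : 0 < t)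
    (h : A (t • u) + A (J.g₁ (t • u) z) = A z) : A u + A (J.g₁ u z) = A z := by
  rw [g₁_smul hu ht, hA.smul hu ht, hA.smul (g₁_mem_cone hu hz) (inv_pos.2 ht)] at h
  have h1 := hA.smul (smul_mem_cone (inv_pos.2 ht) J.e_mem_cone) ht
  rw [smul_inv_smul₀ ht.ne', hA.e] at h1
  linarith

lemma mem_D₀_of_cone {J : EuclideanJordanAlgebra E} {x y : E} (hx : x ∈ J.cone)
    (hy : y ∈ J.cone) (hxy : J.e - x - y ∈ J.cone) : (x, y) ∈ J.D₀ := by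
  refine ⟨⟨hx, ?_⟩, ⟨hy, ?_⟩, add_mem_cone hx hy, ?_⟩
  · have := add_mem_cone hxy hy; rwa [sub_add_cancel] at this
  · have := add_mem_cone hxy hx
    have e : J.e - x - y + x = J.e - y := by abel
    rwa [e] at this
  · have e : J.e - x - y = J.e - (x + y) := by abel
    rwa [e] at hxy

lemma g₁_mem_D {J : EuclideanJordanAlgebra E} {u y : E} (hy : y ∈ J.cone)
    (huy : u - y ∈ J.cone) : J.g₁ u y ∈ J.D := by
  have hu : u ∈ J.cone := by have := add_mem_cone huy hy; rwa [sub_add_cancel] at this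
  refine ⟨g₁_mem_cone hu hy, ?_⟩
  rw [← g₁_self hu, ← map_sub]
  exact g₁_mem_cone hu huy

/-- Replace y by εy and let ε tend to 0. The divergent terms G(εe) cancel by homogeneity, g₁(e -
εy)x tends to x, and the A and B terms cancel in the limit, leaving the identity for G at e - x. -/
lemma isLogarithmic_of_eq {J : EuclideanJordanAlgebra E} {f g h k : E → ℝ}
    (heq : ∀ x y : E, (x, y) ∈ J.D₀ →
      f x + g (J.g₁ (J.e - x) y) = h y + k (J.g₁ (J.e - y) x))
    {A B G : E → ℝ} {C₁ C₂ C₃ C₄ : ℝ} (hA : J.IsSpectralLog A) (hB : J.IsSpectralLog B)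
    (hG : J.IsSpectralLog G) (hC : C₁ + C₂ = C₃ + C₄)
    (hsol : ∀ x ∈ J.D,
        f x = A (J.e - x) + B x + G (J.e - x) + C₁ ∧
        g x = A (J.e - x) + G x + C₂ ∧
        h x = A (J.e - x) + B (J.e - x) + G x + C₃ ∧
        k x = A (J.e - x) + B x + C₄) : J.IsLogarithmic G := by
  have key : ∀ x ∈ J.D, ∀ y ∈ J.cone, G (J.e - x) + G (J.g₁ (J.e - x) y) = G y := by
    intro x hx y hy
    have l1 : Tendsto (fun ε : ℝ => J.e - x - ε • y) (𝓝[>] 0) (𝓝 (J.e - x)) := by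
      have : Tendsto (fun ε : ℝ => J.e - x - ε • y) (𝓝[>] 0) (𝓝 (J.e - x - (0 : ℝ) • y)) :=
        (Continuous.tendsto (by fun_prop) 0).mono_left nhdsWithin_le_nhds
      rwa [zero_smul, sub_zero] at this
    have ev := l1.eventually (J.isOpen_cone.mem_nhds hx.2)
    set q := J.g₁ (J.e - x) y
    have hq : q ∈ J.cone := g₁_mem_cone hx.2 hy
    have hAe := (hA.continuousAt J.e_mem_cone).tendsto
    have hBe := (hB.continuousAt J.e_mem_cone).tendsto
    rw [hA.e] at hAe
    rw [hB.e] at hBe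
    have t1 := hAe.comp (J.tendsto_e_sub q)
    have t2 := hAe.comp (J.tendsto_e_sub y)
    have t3 := hBe.comp (J.tendsto_e_sub y)
    have t4 : Tendsto (fun ε : ℝ => J.e - J.g₁ (J.e - ε • y) x) (𝓝[>] 0) (𝓝 (J.e - x)) :=
      (J.tendsto_g₁ y x).const_sub J.e
    have t5 := (hA.continuousAt hx.2).tendsto.comp t4
    have t6 := (hB.continuousAt hx.1).tendsto.comp (J.tendsto_g₁ y x)
    have lhs := (t1.add_const (A (J.e - x) + B x + G (J.e - x) + G q))
    have rhs := ((t2.add t3).add (t5.add t6)).add_const (G y)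
    have := tendsto_nhds_unique_of_eventuallyEq lhs rhs (by
      filter_upwards [ev, self_mem_nhdsWithin] with ε hε hε0
      have hε0' : (0 : ℝ) < ε := hε0
      have hεy := smul_mem_cone hε0' hy
      have hD0 := mem_D₀_of_cone hx.1 hεy hε
      have h1 := heq _ _ hD0
      have hyD : ε • y ∈ J.D := hD0.2.1
      have m1 : J.g₁ (J.e - x) (ε • y) ∈ J.D := g₁_mem_D hεy hε
      have m2 : J.g₁ (J.e - ε • y) x ∈ J.D := g₁_mem_D hx.1 (by
        have e : J.e - x - ε • y = J.e - ε • y - x := by abel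
        rwa [← e])
      rw [(hsol _ hx).1, (hsol _ m1).2.1, (hsol _ hyD).2.2.1, (hsol _ m2).2.2.2, map_smul,
        hG.smul hq hε0', hG.smul hy hε0'] at h1
      simp only [Function.comp_apply]
      linarith)
    linarith
  intro u hu z hz
  have hm : 0 < 1 + ‖J.mulL‖ * ‖u‖ := by positivity
  have h1 : (1 + ‖J.mulL‖ * ‖u‖) • J.e - u ∈ J.cone := J.smul_e_sub_mem_cone (by linarith)
  have h2 := smul_mem_cone (inv_pos.2 hm) h1
  have h3 := smul_mem_cone (inv_pos.2 hm) hu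
  rw [smul_sub, inv_smul_smul₀ hm.ne'] at h2
  refine hG.logarithmic_smul hu hz (inv_pos.2 hm) ?_
  have := key (J.e - (1 + ‖J.mulL‖ * ‖u‖)⁻¹ • u) ⟨h2, by rwa [sub_sub_cancel]⟩ z hz
  rwa [sub_sub_cancel] at this

/-- Put x = e - ε(y + z) and εy for y, so that e - x - y becomes εz. After cancelling the scale ε,
the right side tends to A(e) + A(z) = A(z). -/
lemma isLogarithmic_of_symm {J : EuclideanJordanAlgebra E} {A : E → ℝ} (hA : J.IsSpectralLog A)
    (heq : ∀ x y : E, x ∈ J.cone → y ∈ J.cone → J.e - x - y ∈ J.cone →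
      A (J.e - x) + A (J.g₁ (J.e - x) (J.e - x - y))
        = A (J.e - y) + A (J.g₁ (J.e - y) (J.e - x - y))) : J.IsLogarithmic A := by
  have key : ∀ y ∈ J.cone, ∀ z ∈ J.cone, A (y + z) + A (J.g₁ (y + z) z) = A z := by
    intro y hy z hz
    have hyz := add_mem_cone hy hz
    have hq := g₁_mem_cone hyz hz
    have hAe := (hA.continuousAt J.e_mem_cone).tendsto
    rw [hA.e] at hAe
    have t1 := hAe.comp (J.tendsto_e_sub y)
    have t2 := (hA.continuousAt hz).tendsto.comp (J.tendsto_g₁ y z)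
    have t3 := tendsto_nhds_unique_of_eventuallyEq (t1.add t2)
      (tendsto_const_nhds (x := A (y + z) + A (J.g₁ (y + z) z))) (by
      filter_upwards [J.eventually_e_sub_mem_cone (y + z), J.eventually_e_sub_mem_cone y,
        self_mem_nhdsWithin] with ε h1 h2 hε
      have hε' : (0 : ℝ) < ε := hε
      have e1 : J.e - (J.e - ε • (y + z)) = ε • (y + z) := sub_sub_cancel _ _
      have e2 : J.e - (J.e - ε • (y + z)) - ε • y = ε • z := by rw [e1, smul_add]; abel
      have h := heq (J.e - ε • (y + z)) (ε • y) h1 (smul_mem_cone hε' hy)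
        (by rw [e2]; exact smul_mem_cone hε' hz)
      rw [e2, e1, map_smul, map_smul, g₁_smul hyz hε', smul_inv_smul₀ hε'.ne', hA.smul hyz hε',
        hA.smul (g₁_mem_cone h2 hz) hε'] at h
      simp only [Function.comp_apply]
      linarith)
    linarith
  intro u hu z hz
  obtain ⟨ε, hε, hε'⟩ := mem_cone_iff.1 hu
  have hm : 0 < 1 + ‖J.mulL‖ * ‖z‖ := by positivity
  have h1 : (1 + ‖J.mulL‖ * ‖z‖) • J.e - z ∈ J.cone := J.smul_e_sub_mem_cone (by linarith)
  set m := 1 + ‖J.mulL‖ * ‖z‖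
  have h2 : (m / ε) • u - z ∈ J.cone := by
    have e : (m / ε) • u - z = (m • J.e - z) + (m / ε) • (u - ε • J.e) := by
      rw [smul_sub, smul_smul, div_mul_cancel₀ _ hε.ne']; abel
    rw [e]
    exact add_squares_mem_cone h1 (smul_mem_squares (by positivity) hε')
  refine hA.logarithmic_smul hu hz (t := m / ε) (by positivity) ?_
  have := key _ h2 z hz
  rwa [sub_add_cancel] at this

/-- All three spectral logarithms are logarithmic. -/
theorem exists_logarithmic {J : EuclideanJordanAlgebra E} {f g h k : E → ℝ}
    (hf : ContinuousOn f J.D) (hg : ContinuousOn g J.D)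
    (hh : ContinuousOn h J.D) (hk : ContinuousOn k J.D)
    (heq : ∀ x y : E, (x, y) ∈ J.D₀ →
      f x + g (J.g₁ (J.e - x) y) = h y + k (J.g₁ (J.e - y) x)) :
    ∃ (A B G : E → ℝ) (C₁ C₂ C₃ C₄ : ℝ), (J.IsSpectralLog A ∧ J.IsLogarithmic A) ∧
      (J.IsSpectralLog B ∧ J.IsLogarithmic B) ∧ (J.IsSpectralLog G ∧ J.IsLogarithmic G) ∧
      C₁ + C₂ = C₃ + C₄ ∧ ∀ x ∈ J.D,
        f x = A (J.e - x) + B x + G (J.e - x) + C₁ ∧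
        g x = A (J.e - x) + G x + C₂ ∧
        h x = A (J.e - x) + B (J.e - x) + G x + C₃ ∧
        k x = A (J.e - x) + B x + C₄ := by
  obtain ⟨A, B, G, C₁, C₂, C₃, C₄, hA, hB, hG, hC, hsol⟩ := exists_spectralLogs hf hg hh hk heq
  have lG := isLogarithmic_of_eq heq hA hB hG hC hsol
  have lB : J.IsLogarithmic B := by
    refine isLogarithmic_of_eq (f := h) (g := k) (h := f) (k := g) (fun x y hxy => ?_)
      hA hG hB hC.symm fun x hx => ?_
    · refine (heq y x ⟨hxy.2.1, hxy.1, ?_⟩).symm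
      rw [add_comm]; exact hxy.2.2
    · obtain ⟨h1, h2, h3, h4⟩ := hsol x hx
      refine ⟨?_, ?_, ?_, ?_⟩ <;> linarith
  refine ⟨A, B, G, C₁, C₂, C₃, C₄, ⟨hA, ?_⟩, ⟨hB, lB⟩, ⟨hG, lG⟩, hC, hsol⟩
  -- The identities for G and B remove all their terms from the equation; what survives is a
  -- symmetric relation for A alone, since e - g₁(e-x)y = g₁(e-x)(e-x-y).
  refine isLogarithmic_of_symm hA fun x y hx hy hxy => ?_
  have hD0 := mem_D₀_of_cone hx hy hxy
  have hxD : x ∈ J.D := hD0.1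
  have hyD : y ∈ J.D := hD0.2.1
  have hyx : J.e - y - x ∈ J.cone := by
    have e : J.e - x - y = J.e - y - x := by abel
    rwa [← e]
  have h1 := heq x y hD0
  rw [(hsol _ hxD).1, (hsol _ (g₁_mem_D hy hxy)).2.1, (hsol _ hyD).2.2.1,
    (hsol _ (g₁_mem_D hx hyx)).2.2.2] at h1
  have h2 := lG _ hxD.2 _ hy
  have h3 := lB _ hyD.2 _ hx
  have e1 : J.g₁ (J.e - x) (J.e - x - y) = J.e - J.g₁ (J.e - x) y := by
    rw [map_sub, g₁_self hxD.2]
  have e2 : J.g₁ (J.e - y) (J.e - x - y) = J.e - J.g₁ (J.e - y) x := by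
    rw [sub_right_comm, map_sub, g₁_self hyD.2]
  rw [e1, e2]
  linarith

/-! ### The exponential map -/

lemma exp_apply_of_eigenvector [CompleteSpace E] (T : E →L[ℝ] E) {v : E} {μ : ℝ}
    (h : T v = μ • v) : NormedSpace.exp T v = Real.exp μ • v := by
  have h1 := (ContinuousLinearMap.apply ℝ E v).hasSum
    (NormedSpace.exp_series_hasSum_exp' (𝕂 := ℝ) T)
  have h2 : HasSum (fun n : ℕ => ((n.factorial : ℝ)⁻¹ • μ ^ n) • v) (Real.exp μ • v) := by
    rw [Real.exp_eq_exp_ℝ]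
    exact (NormedSpace.exp_series_hasSum_exp' (𝕂 := ℝ) μ).smul_const v
  have hpow : ∀ n : ℕ, (T ^ n) v = μ ^ n • v := by
    intro n
    induction n with
    | zero => simp
    | succ n ih => rw [pow_succ, mul_apply_eq_comp, h, map_smul, ih, smul_smul, pow_succ']
  simp only [map_smul, ContinuousLinearMap.apply_apply, hpow] at h1
  simp only [smul_assoc] at h2
  exact h1.unique h2

/-- The exponential map of the Jordan algebra. -/
noncomputable def jexp (J : EuclideanJordanAlgebra E) (z : E) : E :=
  NormedSpace.exp (J.mulL z) J.e

lemma continuous_jexp (J : EuclideanJordanAlgebra E) : Continuous J.jexp := by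
  have := J.finiteDimensional
  have : CompleteSpace E := FiniteDimensional.complete ℝ E
  unfold jexp
  have h : Continuous (NormedSpace.exp : (E →L[ℝ] E) → E →L[ℝ] E) :=
    continuous_iff_continuousAt.2 fun x => (NormedSpace.exp_analytic (𝕂 := ℝ) x).continuousAt
  exact (h.comp J.mulL.continuous).clm_apply continuous_const

lemma IsSystem.jexp_sum {J : EuclideanJordanAlgebra E} {ι : Type*} [Fintype ι] {c : ι → E}
    (hc : J.IsSystem c) (z : ι → ℝ) : J.jexp (∑ i, z i • c i) = ∑ i, Real.exp (z i) • c i := by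
  have := J.finiteDimensional
  have : CompleteSpace E := FiniteDimensional.complete ℝ E
  rw [jexp, ← hc.sum_eq, map_sum]
  refine Finset.sum_congr rfl fun j _ => exp_apply_of_eigenvector _ ?_
  rw [mulL_apply, hc.mul_single]

lemma abs_log_one_add_sub_le {x : ℝ} (hx : |x| ≤ 1 / 2) : |Real.log (1 + x) - x| ≤ 2 * x ^ 2 := by
  obtain ⟨h1, h2⟩ := abs_le.1 hx
  have hp : 0 < 1 + x := by linarith
  have h3 := Real.log_le_sub_one_of_pos hp
  have h4 := Real.one_sub_inv_le_log_of_pos hp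
  have h5 : 1 - (1 + x)⁻¹ - x ≥ -(2 * x ^ 2) := by
    have e : 1 - (1 + x)⁻¹ - x = -(x ^ 2 / (1 + x)) := by field_simp; ring
    rw [e]
    have : x ^ 2 / (1 + x) ≤ 2 * x ^ 2 := by
      rw [div_le_iff₀ hp]; nlinarith [sq_nonneg x]
    linarith
  rw [abs_le]
  constructor <;> nlinarith [sq_nonneg x]

/-- Take logarithms of 1 + z i in a frame of x. Each z i is an eigenvalue of L(x), hence bounded by
‖L‖‖x‖, which gives an error quadratic in x and uniform over frames. -/
lemma exists_log (J : EuclideanJordanAlgebra E) {x : E} (hx : ‖J.mulL‖ * ‖x‖ ≤ 1 / 2) :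
    ∃ w, J.jexp w = J.e + x ∧ ‖w - x‖ ≤ 2 * (‖J.mulL‖ * ‖x‖) * ‖x‖ := by
  obtain ⟨r, c, z, hc, hxz⟩ := J.exists_frame x
  have hs := hc.isSystem
  have hz : ∀ i, |z i| ≤ ‖J.mulL‖ * ‖x‖ := by
    intro i
    have h1 := J.norm_mul_le x (c i)
    have h2 := hs.mul_single z i
    rw [← hxz] at h2
    rw [h2, norm_smul, Real.norm_eq_abs] at h1
    exact le_of_mul_le_mul_right h1 (norm_pos_iff.2 (hc.ne_zero i))
  refine ⟨∑ i, Real.log (1 + z i) • c i, ?_, ?_⟩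
  · rw [hs.jexp_sum, hxz, ← hs.sum_eq, ← Finset.sum_add_distrib]
    refine Finset.sum_congr rfl fun i _ => ?_
    have := (abs_le.1 ((hz i).trans hx)).1
    rw [Real.exp_log (by linarith), add_smul, one_smul]
  · refine le_of_sq_le_sq ?_ (by positivity)
    have e : ∑ i, Real.log (1 + z i) • c i - x = ∑ i, (Real.log (1 + z i) - z i) • c i := by
      rw [hxz, ← Finset.sum_sub_distrib]
      exact Finset.sum_congr rfl fun i _ => (sub_smul _ _ _).symm
    have hx2 : ‖x‖ ^ 2 = ∑ i, z i ^ 2 * ‖c i‖ ^ 2 := by rw [← hs.norm_sq, ← hxz]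
    rw [e, hs.norm_sq, mul_pow, hx2, Finset.mul_sum]
    refine Finset.sum_le_sum fun i _ => ?_
    rw [← mul_assoc]
    refine mul_le_mul_of_nonneg_right ?_ (sq_nonneg _)
    rw [← mul_pow, ← sq_abs (Real.log (1 + z i) - z i), ← sq_abs (_ * z i)]
    refine pow_le_pow_left₀ (abs_nonneg _) ((abs_log_one_add_sub_le ((hz i).trans hx)).trans ?_) 2
    rw [abs_mul, abs_of_nonneg (by positivity : 0 ≤ 2 * (‖J.mulL‖ * ‖x‖)), ← sq_abs, sq,
      ← mul_assoc]
    exact mul_le_mul_of_nonneg_right (mul_le_mul_of_nonneg_left (hz i) two_pos.le) (abs_nonneg _)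

/-! ### The differential of a logarithmic function at the neutral element -/

section Logarithmic

variable {J : EuclideanJordanAlgebra E} {A : E → ℝ}

lemma jexp_mem_cone (J : EuclideanJordanAlgebra E) (z : E) : J.jexp z ∈ J.cone := by
  obtain ⟨r, c, l, hc, rfl⟩ := J.exists_frame z
  rw [hc.isSystem.jexp_sum]
  exact hc.isSystem.mem_cone fun i => Real.exp_pos _

lemma IsSpectralLog.continuous_jexp (hA : J.IsSpectralLog A) :
    Continuous fun z => A (J.jexp z) :=
  hA.continuousOn.comp_continuous J.continuous_jexp J.jexp_mem_cone

lemma IsSpectralLog.frame_jexp (hA : J.IsSpectralLog A) {r : ℕ} {c : Fin r → E}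
    (hc : J.IsFrame c) : ∃ κ : Fin r → ℝ, (∀ z : Fin r → ℝ,
      A (J.jexp (∑ i, z i • c i)) = ∑ i, κ i * z i) ∧
      ∀ l ∈ Pos (Fin r), A (∑ i, l i • c i) = logSum κ l := by
  obtain ⟨κ, hκ⟩ := hA.frame r c hc
  refine ⟨κ, fun z => ?_, hκ⟩
  rw [hc.isSystem.jexp_sum, hκ _ fun i => Real.exp_pos _]
  simp only [logSum, Real.log_exp]

lemma IsSpectralLog.jexp_smul (hA : J.IsSpectralLog A) (t : ℝ) (z : E) :
    A (J.jexp (t • z)) = t * A (J.jexp z) := by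
  obtain ⟨r, c, l, hc, rfl⟩ := J.exists_frame z
  obtain ⟨κ, hκ, -⟩ := hA.frame_jexp hc
  rw [Finset.smul_sum]
  simp only [smul_smul]
  rw [hκ, hκ, Finset.mul_sum]
  exact Finset.sum_congr rfl fun i _ => by ring

/-- A has one-sided directional derivatives at e, even along moving directions, although no
differentiability is assumed: A ∘ exp is continuous and homogeneous, and exp(tv) = e + t z t has a
solution v close to z t. -/
lemma IsSpectralLog.tendsto_div (hA : J.IsSpectralLog A) {z : ℝ → E} {z₀ : E}
    (hz : Tendsto z (𝓝[>] 0) (𝓝 z₀)) :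
    Tendsto (fun t => t⁻¹ * A (J.e + t • z t)) (𝓝[>] 0) (𝓝 (A (J.jexp z₀))) := by
  have hv : ∀ t : ℝ, ∃ v, 0 < t → t * (‖J.mulL‖ * ‖z t‖) ≤ 1 / 2 →
      J.jexp (t • v) = J.e + t • z t ∧ ‖v - z t‖ ≤ t * (2 * (‖J.mulL‖ * ‖z t‖) * ‖z t‖) := by
    intro t
    by_cases h : 0 < t ∧ t * (‖J.mulL‖ * ‖z t‖) ≤ 1 / 2
    · obtain ⟨ht, h⟩ := h
      have hn : ‖t • z t‖ = t * ‖z t‖ := by rw [norm_smul, Real.norm_eq_abs, abs_of_pos ht]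
      obtain ⟨w, h1, h2⟩ := J.exists_log (x := t • z t) (by rw [hn]; linarith)
      refine ⟨t⁻¹ • w, fun _ _ => ⟨by rw [smul_inv_smul₀ ht.ne', h1], ?_⟩⟩
      have e : t⁻¹ • w - z t = t⁻¹ • (w - t • z t) := by rw [smul_sub, inv_smul_smul₀ ht.ne']
      rw [e, norm_smul, Real.norm_eq_abs, abs_of_pos (inv_pos.2 ht), inv_mul_le_iff₀ ht]
      rw [hn] at h2
      linarith
    · exact ⟨0, fun h1 h2 => absurd ⟨h1, h2⟩ h⟩
  choose v hv using hv
  have hid : Tendsto (fun t : ℝ => t) (𝓝[>] 0) (𝓝 0) := tendsto_id.mono_left nhdsWithin_le_nhds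
  have hn := hz.norm
  have ev : ∀ᶠ t in 𝓝[>] (0 : ℝ), t * (‖J.mulL‖ * ‖z t‖) ≤ 1 / 2 := by
    have := hid.mul (hn.const_mul ‖J.mulL‖)
    rw [zero_mul] at this
    exact (this.eventually (gt_mem_nhds (by norm_num : (0 : ℝ) < 1 / 2))).mono fun _ h => h.le
  have hv0 : Tendsto (fun t => v t - z t) (𝓝[>] 0) (𝓝 0) := by
    have := hid.mul (((hn.const_mul ‖J.mulL‖).const_mul 2).mul hn)
    rw [zero_mul] at this
    refine squeeze_zero_norm' ?_ this
    filter_upwards [ev, self_mem_nhdsWithin] with t h1 h2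
    exact (hv t h2 h1).2
  have hvz : Tendsto v (𝓝[>] 0) (𝓝 z₀) := by simpa using hv0.add hz
  refine ((hA.continuous_jexp.tendsto z₀).comp hvz).congr' ?_
  filter_upwards [ev, self_mem_nhdsWithin] with t h1 h2
  have h2' : (0 : ℝ) < t := h2
  rw [← (hv t h2 h1).1, hA.jexp_smul, inv_mul_cancel_left₀ h2'.ne']
  rfl

/-- g₁(u) = P(v) for u = v⁻², and A(v⁻²) = -2A(v) along the frame of v. -/
lemma IsLogarithmic.P_apply (hL : J.IsLogarithmic A) (hA : J.IsSpectralLog A) {v z : E}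
    (hv : v ∈ J.cone) (hz : z ∈ J.cone) : A (J.P v z) = 2 * A v + A z := by
  obtain ⟨r, c, l, hc, rfl⟩ := J.exists_frame v
  have hl := hc.mem_cone_iff.1 hv
  obtain ⟨κ, hκ⟩ := hA.frame r c hc
  have hi : 1 / (l * l) ∈ Pos (Fin r) := Pos.div Pos.one (Pos.mul hl hl)
  have h := hL _ (hc.mem_cone_iff.2 hi) z hz
  rw [hc.isSystem.g₁_sum hi, hκ _ hi, logSum_div _ Pos.one (Pos.mul hl hl), logSum_one,
    logSum_mul _ hl hl] at h
  have e : ∑ i, (√((1 / (l * l)) i))⁻¹ • c i = ∑ i, l i • c i := by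
    refine Finset.sum_congr rfl fun i _ => ?_
    simp only [Pi.div_apply, Pi.one_apply, Pi.mul_apply]
    rw [Real.sqrt_div zero_le_one, Real.sqrt_one, Real.sqrt_mul_self (hl i).le, one_div, inv_inv]
  rw [e] at h
  rw [hκ l hl]
  linarith

lemma eventually_e_add_mem_cone (J : EuclideanJordanAlgebra E) {z : ℝ → E} (hz : Continuous z) :
    ∀ᶠ t in 𝓝[>] (0 : ℝ), J.e + t • z t ∈ J.cone := by
  have : Tendsto (fun t : ℝ => J.e + t • z t) (𝓝[>] 0) (𝓝 (J.e + (0 : ℝ) • z 0)) :=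
    (Continuous.tendsto (by fun_prop) 0).mono_left nhdsWithin_le_nhds
  rw [zero_smul, add_zero] at this
  exact this.eventually (J.isOpen_cone.mem_nhds J.e_mem_cone)

lemma IsSpectralLog.tendsto_div_of_continuous (hA : J.IsSpectralLog A) {z : ℝ → E}
    (hz : Continuous z) :
    Tendsto (fun t => t⁻¹ * A (J.e + t • z t)) (𝓝[>] 0) (𝓝 (A (J.jexp (z 0)))) :=
  hA.tendsto_div ((hz.tendsto 0).mono_left nhdsWithin_le_nhds)

/-- Differentiate A(P(e + tu)(e + tz)) = 2A(e + tu) + A(e + tz) at t = 0; the argument on the left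
is e + t(2u + z) up to second order. -/
lemma IsLogarithmic.jexp_add (hL : J.IsLogarithmic A) (hA : J.IsSpectralLog A) (u z : E) :
    A (J.jexp (u + z)) = A (J.jexp u) + A (J.jexp z) := by
  have h2 : ∀ u, A (J.jexp ((2 : ℝ) • u + z)) = 2 * A (J.jexp u) + A (J.jexp z) := by
    intro u
    let ζ : ℝ → E := fun t => (2 : ℝ) • u + z +
      t • ((2 : ℝ) • J.mul u z + J.mul u u + t • J.P u z)
    have hζ : Continuous ζ := by fun_prop
    have e : ∀ t : ℝ, J.P (J.e + t • u) (J.e + t • z) = J.e + t • ζ t := by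
      intro t
      simp only [ζ, P_self, map_add, map_smul, LinearMap.add_apply, LinearMap.smul_apply, J.mul_e,
        J.e_mul]
      module
    have t1 := hA.tendsto_div_of_continuous hζ
    have t2 := hA.tendsto_div_of_continuous (continuous_const (y := u))
    have t3 := hA.tendsto_div_of_continuous (continuous_const (y := z))
    have e0 : ζ 0 = (2 : ℝ) • u + z := by simp [ζ]
    rw [e0] at t1
    refine tendsto_nhds_unique_of_eventuallyEq t1 ((t2.const_mul 2).add t3) ?_
    filter_upwards [J.eventually_e_add_mem_cone (continuous_const (y := u)),
      J.eventually_e_add_mem_cone (continuous_const (y := z))] with t h1 h2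
    rw [← e, hL.P_apply hA h1 h2]; ring
  have h3 := h2 ((1 / 2 : ℝ) • u)
  rw [hA.jexp_smul, smul_smul] at h3
  norm_num at h3
  linarith

/-- With w = e + c and v = w², the element (v + 2tq)² is both the square of P(w)(e + tq) and P(v)(e
+ t(5/2)q + O(t²)). Comparing first-order terms gives (5/2)φ(q) = 2φ(q) for φ = A ∘ exp: L(v) acts
on q by the arithmetic mean 5/2 of 1 and 4, P(w) by the geometric mean 2. -/
lemma IsLogarithmic.jexp_half (hL : J.IsLogarithmic A) (hA : J.IsSpectralLog A) {c q : E}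
    (hc : J.mul c c = c) (hq : J.mul c q = (1 / 2 : ℝ) • q) : A (J.jexp q) = 0 := by
  set w := J.e + c
  set v := J.e + (3 : ℝ) • c
  have hw : w ∈ J.cone := add_squares_mem_cone J.e_mem_cone (idem_mem_squares hc)
  have hv : v ∈ J.cone := add_squares_mem_cone J.e_mem_cone
    (smul_mem_squares (by norm_num) (idem_mem_squares hc))
  have hww : J.mul w w = v := by
    simp only [w, v, map_add, LinearMap.add_apply, J.mul_e, J.e_mul, hc]; module
  have hwq : J.P w q = (2 : ℝ) • q := by
    rw [P_self, hww]
    simp only [w, v, map_add, map_smul, LinearMap.add_apply, LinearMap.smul_apply, J.e_mul, hq]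
    module
  have hvq' : J.mul v q = (5 / 2 : ℝ) • q := by
    simp only [v, map_add, map_smul, LinearMap.add_apply, LinearMap.smul_apply, J.e_mul, hq]
    module
  have hvv : J.mul v v = J.e + (15 : ℝ) • c := by
    simp only [v, map_add, map_smul, LinearMap.add_apply, LinearMap.smul_apply, J.mul_e, J.e_mul,
      hc]
    module
  have hvq : J.P v q = (4 : ℝ) • q := by
    rw [P_self, hvv, hvq', map_smul, hvq']
    simp only [map_add, map_smul, LinearMap.add_apply, LinearMap.smul_apply, J.e_mul, hq]
    module
  obtain ⟨p, hp⟩ : ∃ p, J.P v p = J.mul q q := by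
    have h := (J.isSystem_pair hc).P_P_inv (v := fun b => if b then (4 : ℝ) else 1)
      (by rintro (_ | _) <;> norm_num) (J.mul q q)
    have e : ∑ b : Bool, (if b then (4 : ℝ) else 1) • (if b then c else J.e - c) = v := by
      simp only [Fintype.sum_bool, v]; simp; module
    rw [e] at h
    exact ⟨_, h⟩
  -- compare the two ways of factoring `(w² + 2tq)²`
  let ζ : ℝ → E := fun t => (5 / 2 : ℝ) • q + t • ((4 : ℝ) • p)
  have hζ : Continuous ζ := by fun_prop
  have e1 : ∀ t : ℝ, J.P w (J.e + t • q) = v + (2 * t) • q := by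
    intro t
    rw [map_add, map_smul, P_apply_e, hww, hwq, smul_smul, _root_.mul_comm]
  have e2 : ∀ t : ℝ, J.P v (J.e + t • ζ t) = J.mul (v + (2 * t) • q) (v + (2 * t) • q) := by
    intro t
    simp only [ζ, map_add, map_smul, LinearMap.add_apply, LinearMap.smul_apply, P_apply_e, hvq,
      hp, J.mul_comm q v, hvq']
    module
  have t1 := hA.tendsto_div_of_continuous hζ
  have t2 := hA.tendsto_div_of_continuous (continuous_const (y := q))
  have e0 : ζ 0 = (5 / 2 : ℝ) • q := by simp [ζ]
  rw [e0, hA.jexp_smul] at t1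
  have h := tendsto_nhds_unique_of_eventuallyEq t1 (t2.const_mul 2) (by
    filter_upwards [J.eventually_e_add_mem_cone (continuous_const (y := q)),
      J.eventually_e_add_mem_cone hζ] with t h1 h2
    have a1 := hL.P_apply hA hw h1
    have a2 := hL.P_apply hA hv h2
    have hm : v + (2 * t) • q ∈ J.cone := by rw [← e1]; exact P_mem_cone hw h1
    rw [e2, hA.mul_self hm, ← e1, a1, ← hww, hA.mul_self hw] at a2
    have a3 : A (J.e + t • ζ t) = 2 * A (J.e + t • q) := by linarith
    rw [a3]; ring)
  linarith

/-- cx - P(c)x = 2(cx - c(cx)) lies in the Peirce 1/2-space of c, where the differential vanishes.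
-/
lemma IsLogarithmic.jexp_mul_idem (hL : J.IsLogarithmic A) (hA : J.IsSpectralLog A) {c : E}
    (hc : J.mul c c = c) (x : E) : A (J.jexp (J.mul c x)) = A (J.jexp (J.P c x)) := by
  have hq : J.mul c ((2 : ℝ) • (J.mul c x - J.mul c (J.mul c x)))
      = (1 / 2 : ℝ) • ((2 : ℝ) • (J.mul c x - J.mul c (J.mul c x))) := by
    have h := J.idem_cubic hc x
    rw [map_smul, map_sub]
    linear_combination (norm := module) -h
  have e : J.mul c x = J.P c x + (2 : ℝ) • (J.mul c x - J.mul c (J.mul c x)) := by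
    rw [P_self, hc]; module
  conv_lhs => rw [e]
  rw [hL.jexp_add hA, hL.jexp_half hA hc hq, add_zero]

/-- Evaluate the differential at cd = dc in two ways: P(c)d is a multiple of c and P(d)c a multiple
of d, with equal coefficients because the norms agree. -/
lemma IsLogarithmic.jexp_eq_of_inner_ne_zero (hL : J.IsLogarithmic A) (hA : J.IsSpectralLog A)
    {c d : E} (hc : J.IsPrimitive c) (hd : J.IsPrimitive d) (h : inner ℝ c d ≠ 0) :
    A (J.jexp c) = A (J.jexp d) := by
  have h1 := hL.jexp_mul_idem hA hc.1.1 d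
  have h2 := hL.jexp_mul_idem hA hd.1.1 c
  rw [hc.P_eq, hA.jexp_smul] at h1
  rw [hd.P_eq, hA.jexp_smul, J.mul_comm, h1, real_inner_comm c d, hc.norm_eq hd h] at h2
  have hp : 0 < ‖d‖ ^ 2 := by have := norm_pos_iff.2 hd.1.2; positivity
  exact mul_left_cancel₀ (div_ne_zero h hp.ne') h2

end Logarithmic

/-! ### Simple algebras -/

/-- Primitive idempotents with different values of φ are orthogonal and so annihilate each other.
The spans of {φ = φ c₀} and {φ ≠ φ c₀} together contain every frame, hence fill E, and associativity
of the inner product makes them subalgebras; both nonzero would contradict simplicity. -/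
lemma IsSimple.exists_const {J : EuclideanJordanAlgebra E} (hJ : J.IsSimple) {φ : E → ℝ}
    (h : ∀ c d, J.IsPrimitive c → J.IsPrimitive d → inner ℝ c d ≠ 0 → φ c = φ d) :
    ∃ κ : ℝ, ∀ c, J.IsPrimitive c → φ c = κ := by
  by_cases hex : ∃ c, J.IsPrimitive c
  swap
  · exact ⟨0, fun c hc => absurd ⟨c, hc⟩ hex⟩
  obtain ⟨c₀, hc₀⟩ := hex
  refine ⟨φ c₀, ?_⟩
  by_contra! hcon
  obtain ⟨d₀, hd₀, hne⟩ := hcon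
  let A : Submodule ℝ E := Submodule.span ℝ {c | J.IsPrimitive c ∧ φ c = φ c₀}
  let B : Submodule ℝ E := Submodule.span ℝ {c | J.IsPrimitive c ∧ φ c ≠ φ c₀}
  have hmul : ∀ a ∈ A, ∀ b ∈ B, J.mul a b = 0 := by
    intro a ha b hb
    induction ha using Submodule.span_induction with
    | zero => simp
    | add x y _ _ hx hy => rw [map_add, LinearMap.add_apply, hx, hy, add_zero]
    | smul t x _ hx => rw [map_smul, LinearMap.smul_apply, hx, smul_zero]
    | mem c hc =>
      induction hb using Submodule.span_induction with
      | zero => simp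
      | add x y _ _ hx hy => rw [map_add, hx, hy, add_zero]
      | smul t x _ hx => rw [map_smul, hx, smul_zero]
      | mem d hd =>
        refine J.idem_orthogonal hc.1.1.1 hd.1.1.1 ?_
        by_contra hcd
        exact hd.2 ((h c d hc.1 hd.1 hcd).symm.trans hc.2)
  have hinner : ∀ a ∈ A, ∀ b ∈ B, inner ℝ a b = 0 := by
    intro a ha b hb
    rw [← J.e_mul a, ← J.inner_mul, hmul a ha b hb, inner_zero_right]
  have htop : A ⊔ B = ⊤ := by
    rw [eq_top_iff]
    intro x _
    obtain ⟨r, c, l, hc, rfl⟩ := J.exists_frame x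
    refine Submodule.sum_mem _ fun i _ => Submodule.smul_mem _ _ ?_
    by_cases hi : φ (c i) = φ c₀
    · exact Submodule.mem_sup_left (Submodule.subset_span ⟨hc.1 i, hi⟩)
    · exact Submodule.mem_sup_right (Submodule.subset_span ⟨hc.1 i, hi⟩)
  have hclA : ∀ x ∈ A, ∀ y ∈ A, J.mul x y ∈ A := by
    intro x hx y hy
    obtain ⟨a, ha, b, hb, hab⟩ := Submodule.mem_sup.1 (htop ▸ Submodule.mem_top (x := J.mul x y))
    have h1 : inner ℝ (J.mul x y) b = 0 := by
      rw [← J.inner_mul, hmul y hy b hb, inner_zero_right]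
    rw [← hab, inner_add_left, hinner a ha b hb, zero_add] at h1
    rw [← hab, inner_self_eq_zero.1 h1, add_zero]
    exact ha
  have hclB : ∀ x ∈ B, ∀ y ∈ B, J.mul x y ∈ B := by
    intro x hx y hy
    obtain ⟨a, ha, b, hb, hab⟩ := Submodule.mem_sup.1 (htop ▸ Submodule.mem_top (x := J.mul x y))
    have h1 : inner ℝ a (J.mul x y) = 0 := by
      rw [J.inner_mul, hmul a ha x hx, inner_zero_left]
    rw [← hab, inner_add_right, hinner a ha b hb, add_zero] at h1
    rw [← hab, inner_self_eq_zero.1 h1, zero_add]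
    exact hb
  refine hJ.2 ⟨A, B, ?_, ?_, ⟨?_, codisjoint_iff.2 htop⟩, hclA, hclB, hmul⟩
  · intro hA
    have : c₀ ∈ A := Submodule.subset_span ⟨hc₀, rfl⟩
    rw [hA] at this
    exact hc₀.1.2 ((Submodule.mem_bot ℝ).1 this)
  · intro hB
    have : d₀ ∈ B := Submodule.subset_span ⟨hd₀, hne⟩
    rw [hB] at this
    exact hd₀.1.2 ((Submodule.mem_bot ℝ).1 this)
  · rw [Submodule.disjoint_def]
    intro x hxA hxB
    exact inner_self_eq_zero.1 (hinner x hxA x hxB)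

lemma det_spec (J : EuclideanJordanAlgebra E) (x : E) : J.IsDet x (J.det x) := by
  have hx : ∃ d, J.IsDet x d := by
    obtain ⟨r, c, l, hc, h⟩ := J.exists_frame x
    exact ⟨_, r, c, l, hc, h, rfl⟩
  rw [det, dif_pos hx]
  exact hx.choose_spec

/-- Continuous logarithmic functions on an irreducible symmetric cone are multiples of the
logarithm of the determinant. -/
theorem IsSimple.eq_log_det {J : EuclideanJordanAlgebra E} (hJ : J.IsSimple) {A : E → ℝ}
    (hA : J.IsSpectralLog A) (hL : J.IsLogarithmic A) :
    ∃ κ : ℝ, ∀ x ∈ J.cone, A x = κ * Real.log (J.det x) := by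
  obtain ⟨κ, hκ⟩ := hJ.exists_const (φ := fun c => A (J.jexp c))
    fun c d hc hd h => hL.jexp_eq_of_inner_ne_zero hA hc hd h
  refine ⟨κ, fun x hx => ?_⟩
  -- Working in the very frame that defines det x, independence of the eigenvalues from the frame is
  -- not needed.
  obtain ⟨r, c, l, hc, hxl, hd⟩ := J.det_spec x
  have hl := hc.mem_cone_iff.1 (hxl ▸ hx)
  obtain ⟨k, hk1, hk2⟩ := hA.frame_jexp hc
  have hki : ∀ i, k i = κ := by
    intro i
    classical
    have h1 := hk1 (Pi.single i 1)
    simp only [Pi.single_apply, ite_smul, one_smul, zero_smul, Finset.sum_ite_eq',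
      Finset.mem_univ, if_true, mul_ite, mul_one, mul_zero] at h1
    rw [← h1]
    exact hκ _ (hc.1 i)
  rw [hd, Real.log_prod fun i _ => (hl i).ne', Finset.mul_sum, hxl, hk2 l hl, logSum]
  exact Finset.sum_congr rfl fun i _ => by rw [hki]

end EuclideanJordanAlgebra

theorem corollary3p6 {E : Type*} [NormedAddCommGroup E] [InnerProductSpace ℝ E]
    (J : EuclideanJordanAlgebra E) (hJ : J.IsSimple) (f g h k : E → ℝ)
    (hf : ContinuousOn f J.D) (hg : ContinuousOn g J.D)
    (hh : ContinuousOn h J.D) (hk : ContinuousOn k J.D)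
    (heq : ∀ x y : E, (x, y) ∈ J.D₀ →
      f x + g (J.g₁ (J.e - x) y) = h y + k (J.g₁ (J.e - y) x)) :
    ∃ κ₁ κ₂ κ₃ C₁ C₂ C₃ C₄ : ℝ,
      (∀ x ∈ J.D,
        f x = κ₁ * Real.log (J.det (J.e - x)) + κ₂ * Real.log (J.det x)
            + κ₃ * Real.log (J.det (J.e - x)) + C₁ ∧
        g x = κ₁ * Real.log (J.det (J.e - x)) + κ₃ * Real.log (J.det x) + C₂ ∧
        h x = κ₁ * Real.log (J.det (J.e - x)) + κ₂ * Real.log (J.det (J.e - x))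
            + κ₃ * Real.log (J.det x) + C₃ ∧
        k x = κ₁ * Real.log (J.det (J.e - x)) + κ₂ * Real.log (J.det x) + C₄) ∧
      C₁ + C₂ = C₃ + C₄ := by
  obtain ⟨A, B, G, C₁, C₂, C₃, C₄, ⟨hA, lA⟩, ⟨hB, lB⟩, ⟨hG, lG⟩, hC, hsol⟩ :=
    EuclideanJordanAlgebra.exists_logarithmic hf hg hh hk heq
  obtain ⟨κ₁, h₁⟩ := hJ.eq_log_det hA lA
  obtain ⟨κ₂, h₂⟩ := hJ.eq_log_det hB lB
  obtain ⟨κ₃, h₃⟩ := hJ.eq_log_det hG lG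
  refine ⟨κ₁, κ₂, κ₃, C₁, C₂, C₃, C₄, fun x hx => ?_, hC⟩
  rw [← h₁ _ hx.2, ← h₂ _ hx.1, ← h₂ _ hx.2, ← h₃ _ hx.1, ← h₃ _ hx.2]
  exact hsol x hx
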